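/- **Notation.** For a Borel probability measure $\nu$ on $\mathbb C$ with compact support let $U^\nu(z)=\int\log\frac1{|z-w|}\,d\nu(w)$ and $I(\nu)=\iint\log\frac1{|z-w|}\,d\nu(z)\,d\nu(w)\in(-\infty,+\infty]$. For compact $K\subset\mathbb C$ the logarithmic capacity is $\mathrm{cap}(K)=\exp(-\inf_\nu I(\nu))$, the infimum being over the Borel probability measures $\nu$ on $K$; $K$ is non-polar if $\mathrm{cap}(K)>0$, and then $\nu_K$ denotes its equilibrium measure (the minimizer of $I$) and $g_K(z,\infty)=I(\nu_K)-U^{\nu_K}(z)$. If moreover $0\notin K$, put $1/K=\{1/z:z\in K\}$, $g_K(z,0)=g_{1/K}(1/z,\infty)$ for $z\neq0,\infty$, $g_K(\infty,0)=g_{1/K}(0,\infty)$, and $$\Gamma(K)=\begin{bmatrix}\lim_{z\to0}[g_K(z,0)+\log|z|] & g_K(0,\infty)\\ g_K(\infty,0) & \lim_{z\to\infty}[g_K(z,\infty)-\log|z|]\end{bmatrix}.$$ For a real $2\times2$ matrix $\Gamma=(\gamma_{ik})$ let $\mathrm{val}(\Gamma)=\max_s\min\{\gamma_{11}s_1+\gamma_{12}s_2,\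 \gamma_{21}s_1+\gamma_{22}s_2\}$, the maximum being over $s_1,s_2\ge0$ with $s_1+s_2=1$. Put $\gamma_{0,\infty}(K)=\mathrm{val}(\Gamma(K))$ and $\mathrm{cap}_{0,\infty}(K)=e^{-\gamma_{0,\infty}(K)}$. **Proposition 5.3.** Let $E\subset\mathbb C$ be compact with $\mathrm{cap}(E)=1$. Let $1\le j<n$ be integers and let $r(z)=P(z)/z^j$, where $P$ is a monic polynomial of degree $n$ with complex coefficients and $P(0)\in\{1,-1\}$. Then $K:=r^{-1}(E)$ is a compact non-polar subset of $\mathbb C\setminus\{0\}$, the two limits in $\Gamma(K)$ exist, $\mathrm{cap}_{0,\infty}(K)=1$, and the probability vector $(s_1,s_2)=\left(\frac jn,\frac{n-j}n\right)$ balances $\Gamma(K)$, that is, $$s_1\lim_{z\to0}[g_K(z,0)+\log|z|]+s_2\,g_K(0,\infty)=\gamma_{0,\infty}(K),\qquad s_1\,g_K(\infty,0)+s_2\lim_{z\to\infty}[g_K(z,\infty)-\log|z|]=\gamma_{0,\infty}(K).$$ -/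

import Mathlib

open Filter Topology MeasureTheory Set
open scoped ENNReal Pointwise

noncomputable section

namespace CantorCapacity

/-- The integral of an extended-real-valued function: the integral of the positive part minus
the integral of the negative part. (It is only used for functions which are bounded below and
finite measures, so that the second term is finite.) -/
def eintegral {α : Type*} [MeasurableSpace α] (μ : Measure α) (f : α → EReal) : EReal :=
  ((∫⁻ x, (f x).toENNReal ∂μ : ℝ≥0∞) : EReal) - ((∫⁻ x, (-f x).toENNReal ∂μ : ℝ≥0∞) : EReal)

/-- The logarithmic kernel `log (1 / |z - w|)`, with value `+∞` for `z = w`. -/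
def logKernel (z w : ℂ) : EReal := -ENNReal.log ‖z - w‖ₑ

/-- The logarithmic potential `U^ν(z) = ∫ log (1 / |z - w|) dν(w)`. -/
def logPotential (ν : Measure ℂ) (z : ℂ) : EReal := eintegral ν (fun w => logKernel z w)

/-- The logarithmic energy `I(ν) = ∬ log (1 / |z - w|) dν(z) dν(w)`, with values in `(-∞, +∞]`
for a probability measure `ν` with compact support. -/
def logEnergy (ν : Measure ℂ) : EReal :=
  eintegral (ν.prod ν) (fun p => logKernel p.1 p.2)

/-- The set `𝓜(K)` of Borel probability measures on `K`. -/
def probMeasuresOn (K : Set ℂ) : Set (Measure ℂ) := {ν | IsProbabilityMeasure ν ∧ ν Kᶜ = 0}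

/-- The logarithmic capacity `cap(K) = exp (- inf_{ν ∈ 𝓜(K)} I(ν))`. A compact set is
non-polar precisely when this is positive. -/
def logCapacity (K : Set ℂ) : ℝ≥0∞ := EReal.exp (-(⨅ ν ∈ probMeasuresOn K, logEnergy ν))

/-- `ν ∈ 𝓜(K)` is an equilibrium measure for `K` if it minimizes the energy over `𝓜(K)`. -/
def IsEquilibriumMeasure (K : Set ℂ) (ν : Measure ℂ) : Prop :=
  ν ∈ probMeasuresOn K ∧ ∀ μ ∈ probMeasuresOn K, logEnergy ν ≤ logEnergy μ

open Classical in
/-- The equilibrium measure of `K`, which exists and is unique for compact non-polar `K`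
(`0` if there is no minimizer). -/
def equilibriumMeasure (K : Set ℂ) : Measure ℂ :=
  if h : ∃ ν, IsEquilibriumMeasure K ν then h.choose else 0

/-- The Green's function `g_K(z, ∞) = I(ν_K) - U^{ν_K}(z)` with pole at `∞`, for finite `z`.
For compact non-polar `K` both terms are finite at every `z`. -/
def greenInfty (K : Set ℂ) (z : ℂ) : ℝ :=
  (logEnergy (equilibriumMeasure K) - logPotential (equilibriumMeasure K) z).toReal

/-- The Green's function `g_K(z, 0) = g_{1/K}(1/z, ∞)` with pole at `0`, for `z ≠ 0, ∞`;
here `K⁻¹ = {z | z⁻¹ ∈ K}`. -/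
def greenZero (K : Set ℂ) (z : ℂ) : ℝ := greenInfty K⁻¹ z⁻¹

/-- The value `g_K(∞, 0) = g_{1/K}(1/∞, ∞) = g_{1/K}(0, ∞)`. -/
def greenZeroAtInfty (K : Set ℂ) : ℝ := greenInfty K⁻¹ 0

/-- Cantor's matrix `Γ(K)` with respect to `0` and `∞`. -/
def cantorMatrix (K : Set ℂ) : Matrix (Fin 2) (Fin 2) ℝ :=
  !![limUnder (𝓝[≠] (0 : ℂ)) (fun z => greenZero K z + Real.log ‖z‖), greenInfty K 0;
     greenZeroAtInfty K,
       limUnder (Bornology.cobounded ℂ) (fun z => greenInfty K z - Real.log ‖z‖)]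

/-- The value of a `2 × 2` matrix: the maximum over probability vectors `s` of the smaller of
the two entries of `Γ s`. -/
def matrixValue (Γ : Matrix (Fin 2) (Fin 2) ℝ) : ℝ :=
  sSup ((fun s : Fin 2 → ℝ =>
    min (Γ 0 0 * s 0 + Γ 0 1 * s 1) (Γ 1 0 * s 0 + Γ 1 1 * s 1)) '' stdSimplex ℝ (Fin 2))

/-- Robin's constant `γ_{0,∞}(K) = val Γ(K)`. -/
def robinConstant (K : Set ℂ) : ℝ := matrixValue (cantorMatrix K)

/-- The capacity of `K` with respect to `0` and `∞`. -/
def capZeroInfty (K : Set ℂ) : ℝ := Real.exp (-robinConstant K)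

/-- The preimage of `E ⊆ ℂ` under the rational map `P(z) / z ^ j` (with `j ≥ 1` and `P(0) ≠ 0`);
the poles `0` and `∞` are mapped to `∞ ∉ E`. -/
def ratPreimage (P : Polynomial ℂ) (j : ℕ) (E : Set ℂ) : Set ℂ :=
  {z | z ≠ 0 ∧ P.eval z / z ^ j ∈ E}

end CantorCapacity

end

noncomputable section

namespace CantorCapacity

/-! Write `I = I(μ)` for the energy of the equilibrium measure `μ` of `K`, and `m = ∫ log |w|
dμ(w)`, so that `g_K(0,∞) = I + m`; let `I'`, `m'` be the same numbers for `1/K`. The theorem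
reduces to three linear relations: `n I + j m = 0`, its counterpart `n I' + (n - j) m' = 0`, and the
symmetry `I + m = I' + m'`. Together they say that `Γ(K)` is symmetric and kills the positive vector
`(j/n, (n-j)/n)`, and such a matrix has value zero (`matrixValue_eq_zero`).

The first relation (`natDegree_mul_energy_ratPreimage`) compares the push-forward `r_* μ` with the
equilibrium measure `ν` of `E`, whose energy is zero because `cap(E) = 1`. Factoring `P - u z^j`
over its roots gives `∫ log |u - r(w)| dμ(w) = ∑ ∫ log |z - w| dμ(w) - j m`, the sum being over the
`n` solutions `z` of `r(z) = u`. By Frostman's theorem each summand is at least `-I`, with equality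
unless `z` lies in an exceptional set whose image under `r` is `ν`-null. Hence the mutual energy of
`r_* μ` and `ν` is `n I + j m`; Frostman's theorem for `ν` says that it is zero.

The second relation is the first one for `1/K`, the preimage of `E` under the reversed polynomial
over `z^(n-j)`; here `|P(0)| = 1` makes its leading coefficient unimodular. The symmetry
(`energy_add_logMean_zero_eq`) comes from evaluating one mutual energy in two ways.

Frostman's theorem rests on the variational inequality, lower semicontinuity of potentials and
Maria's maximum principle. The null-set statement rests on Borel sections: a measure of finite
energy lifts through a Lipschitz map to a measure of finite energy. -/

/-! ### Nonnegative kernels, potentials and energies -/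

/-- The kernel `log⁺ (R / |z - w|)`, with value `∞` for `z = w`. -/
def posKernel (R : ℝ) (z w : ℂ) : ℝ≥0∞ :=
  (ENNReal.log (ENNReal.ofReal R / ‖z - w‖ₑ)).toENNReal

/-- The potential of `ν` with respect to the kernel `posKernel R`. -/
def posPot (R : ℝ) (ν : Measure ℂ) (z : ℂ) : ℝ≥0∞ := ∫⁻ w, posKernel R z w ∂ν

/-- The mutual energy of `μ` and `ν` with respect to the kernel `posKernel R`. -/
def posEnergy (R : ℝ) (μ ν : Measure ℂ) : ℝ≥0∞ := ∫⁻ z, posPot R ν z ∂μ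

theorem posKernel_comm (R : ℝ) (z w : ℂ) : posKernel R z w = posKernel R w z := by
  rw [posKernel, posKernel, ← enorm_neg (z - w), neg_sub]

theorem posKernel_self {R : ℝ} (hR : 0 < R) (z : ℂ) : posKernel R z z = ∞ := by
  have : ENNReal.ofReal R ≠ 0 := by simpa using hR
  simp [posKernel, ENNReal.div_zero this]

theorem posKernel_eq_ofReal {R : ℝ} (hR : 0 < R) {z w : ℂ} (h : z ≠ w) :
    posKernel R z w = ENNReal.ofReal (Real.log (R / ‖z - w‖)) := by
  have h1 : 0 < ‖z - w‖ := norm_pos_iff.2 (sub_ne_zero.2 h)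
  rw [posKernel, ← ofReal_norm, ← ENNReal.ofReal_div_of_pos h1,
    ENNReal.log_ofReal_of_pos (div_pos hR h1), EReal.toENNReal_of_ne_top (EReal.coe_ne_top _),
    EReal.toReal_coe]

theorem logKernel_self (z : ℂ) : logKernel z z = ⊤ := by simp [logKernel]

theorem logKernel_eq_coe {z w : ℂ} (h : z ≠ w) :
    logKernel z w = ((-Real.log ‖z - w‖ : ℝ) : EReal) := by
  have h1 : 0 < ‖z - w‖ := norm_pos_iff.2 (sub_ne_zero.2 h)
  rw [logKernel, ← ofReal_norm, ENNReal.log_ofReal_of_pos h1, EReal.coe_neg]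

theorem continuous_posKernel (R : ℝ) :
    Continuous (fun p : ℂ × ℂ => posKernel R p.1 p.2) := by
  unfold posKernel
  have h1 : Continuous (fun x : ℝ≥0∞ => ENNReal.ofReal R / x) := by
    simp only [div_eq_mul_inv]
    exact (ENNReal.continuous_const_mul ENNReal.ofReal_ne_top).comp continuous_inv
  have h2 : Continuous (fun p : ℂ × ℂ => ‖p.1 - p.2‖ₑ) := by fun_prop
  exact EReal.continuous_toENNReal.comp (ENNReal.continuous_log.comp (h1.comp h2))

theorem measurable_posKernel (R : ℝ) :
    Measurable (fun p : ℂ × ℂ => posKernel R p.1 p.2) := (continuous_posKernel R).measurable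

theorem measurable_posKernel_right (R : ℝ) (z : ℂ) :
    Measurable (fun w => posKernel R z w) :=
  Measurable.of_uncurry_left (f := posKernel R) (measurable_posKernel R)

theorem measurable_posPot (R : ℝ) (ν : Measure ℂ) [SFinite ν] :
    Measurable (posPot R ν) :=
  Measurable.lintegral_prod_right (measurable_posKernel R)

theorem posEnergy_comm (R : ℝ) (μ ν : Measure ℂ) [SFinite μ] [SFinite ν] :
    posEnergy R μ ν = posEnergy R ν μ := by
  unfold posEnergy posPot
  rw [lintegral_lintegral_swap (measurable_posKernel R).aemeasurable]
  simp only [posKernel_comm R]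

theorem posKernel_mono {R S : ℝ} (hRS : R ≤ S) (z w : ℂ) :
    posKernel R z w ≤ posKernel S z w := by
  unfold posKernel
  apply EReal.toENNReal_le_toENNReal
  gcongr

theorem posKernel_mul_le {R c : ℝ} (hR : 0 < R) (hc : 1 ≤ c) (z w : ℂ) :
    posKernel (c * R) z w ≤ ENNReal.ofReal (Real.log c) + posKernel R z w := by
  have hc0 : 0 < c := by linarith
  by_cases h : z = w
  · subst h; simp [posKernel_self hR]
  · have h1 : 0 < ‖z - w‖ := norm_pos_iff.2 (sub_ne_zero.2 h)
    rw [posKernel_eq_ofReal (by positivity) h, posKernel_eq_ofReal hR h, mul_div_assoc,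
      Real.log_mul (by positivity) (by positivity)]
    exact ENNReal.ofReal_add_le

/-- Finiteness of the energy does not depend on the normalization of the kernel. -/
theorem posEnergy_ne_top_of_ne_top {R S : ℝ} (hR : 0 < R) (hS : 0 < S) {μ ν : Measure ℂ}
    [IsFiniteMeasure μ] [IsFiniteMeasure ν] (h : posEnergy R μ ν ≠ ∞) : posEnergy S μ ν ≠ ∞ := by
  -- The maximum with 1 supplies the hypothesis `1 ≤ c` of `posKernel_mul_le`.
  set c := max 1 (S / R)
  have hle : posEnergy S μ ν ≤
      ∫⁻ _z, (∫⁻ _w, ENNReal.ofReal (Real.log c) ∂ν) ∂μ + posEnergy R μ ν := by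
    have hm : Measurable (posPot R ν) := measurable_posPot R ν
    unfold posEnergy
    rw [← lintegral_add_right _ hm]
    refine lintegral_mono fun z => ?_
    unfold posPot
    rw [← lintegral_add_right _ (measurable_posKernel_right R z)]
    refine lintegral_mono fun w => ?_
    refine (posKernel_mono ?_ z w).trans (posKernel_mul_le hR (le_max_left _ _) z w)
    calc S = S / R * R := by field_simp
      _ ≤ c * R := by gcongr; exact le_max_right _ _
  refine ne_top_of_le_ne_top ?_ hle
  rw [lintegral_const, lintegral_const]
  exact ENNReal.add_ne_top.2 ⟨ENNReal.mul_ne_top (ENNReal.mul_ne_top ENNReal.ofReal_ne_top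
    (measure_ne_top _ _)) (measure_ne_top _ _), h⟩

/-- On pairs of distance at most `R` the two kernels differ by the constant `log R`. -/
theorem posKernel_toEReal {R : ℝ} (hR : 0 < R) {z w : ℂ} (h : ‖z - w‖ ≤ R) :
    (posKernel R z w : EReal) = Real.log R + logKernel z w := by
  by_cases hzw : z = w
  · subst hzw
    simp [posKernel_self hR, logKernel_self]
  · have h1 : 0 < ‖z - w‖ := norm_pos_iff.2 (sub_ne_zero.2 hzw)
    have h2 : 0 ≤ Real.log (R / ‖z - w‖) := Real.log_nonneg ((one_le_div h1).2 h)
    rw [posKernel_eq_ofReal hR hzw, logKernel_eq_coe hzw, EReal.coe_ennreal_ofReal, max_eq_left h2,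
      Real.log_div hR.ne' h1.ne', ← EReal.coe_add, sub_eq_add_neg]

/-- Since `f ≥ -c`, the negative part has integral at most `c`, so the difference defining
`eintegral` is never `∞ - ∞` and the constant can be moved across. This turns signed logarithmic
integrals into `lintegral`s. -/
theorem eintegral_eq_lintegral_sub {α : Type*} [MeasurableSpace α] (μ : Measure α)
    [IsProbabilityMeasure μ] {f : α → EReal} {g : α → ℝ≥0∞} {c : ℝ} (hc : 0 ≤ c)
    (hg : Measurable g) (hfg : ∀ᵐ x ∂μ, (g x : EReal) = c + f x) :
    eintegral μ f = (∫⁻ x, g x ∂μ : ℝ≥0∞) - (c : EReal) := by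
  have key : ∀ᵐ x ∂μ, g x + (-f x).toENNReal = (f x).toENNReal + ENNReal.ofReal c := by
    filter_upwards [hfg] with x hx
    generalize f x = y at hx
    induction y with
    | bot =>
      exfalso
      rw [EReal.add_bot] at hx
      exact absurd hx (EReal.coe_ennreal_ne_bot _)
    | top =>
      have : g x = ⊤ := by simpa using hx
      simp [this]
    | coe y =>
      have h1 : g x = ENNReal.ofReal (c + y) := by
        have h3 : (0:EReal) ≤ (g x : EReal) := EReal.coe_ennreal_nonneg _
        rw [hx, ← EReal.coe_add] at h3
        have h3' : 0 ≤ c + y := by exact_mod_cast h3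
        rw [← EReal.coe_ennreal_eq_coe_ennreal_iff, hx, EReal.coe_ennreal_ofReal,
          max_eq_left h3', EReal.coe_add]
      have h3 : 0 ≤ c + y := by
        have h3 : (0:EReal) ≤ (g x : EReal) := EReal.coe_ennreal_nonneg _
        rw [hx, ← EReal.coe_add] at h3
        exact_mod_cast h3
      rw [h1, ← EReal.coe_neg, EReal.toENNReal_of_ne_top (EReal.coe_ne_top _),
        EReal.toENNReal_of_ne_top (EReal.coe_ne_top _), EReal.toReal_coe, EReal.toReal_coe]
      rcases le_total 0 y with hy | hy
      · rw [ENNReal.ofReal_of_nonpos (by linarith : -y ≤ 0), add_zero, add_comm c,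
          ENNReal.ofReal_add hy hc]
      · rw [ENNReal.ofReal_of_nonpos hy, zero_add, ← ENNReal.ofReal_add h3 (by linarith)]
        congr 1; ring
  have hint := lintegral_congr_ae key
  rw [lintegral_add_left hg, lintegral_add_right _ measurable_const, lintegral_const,
    measure_univ, mul_one] at hint
  have hB : ∫⁻ x, (-f x).toENNReal ∂μ ≤ ENNReal.ofReal c := by
    calc _ ≤ ∫⁻ _x, ENNReal.ofReal c ∂μ := by
          refine lintegral_mono_ae ?_
          filter_upwards [hfg] with x hx
          generalize f x = y at hx
          induction y with
          | bot =>
            exfalso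
            rw [EReal.add_bot] at hx
            exact absurd hx (EReal.coe_ennreal_ne_bot _)
          | top => simp
          | coe y =>
            have h3 : (0:EReal) ≤ (g x : EReal) := EReal.coe_ennreal_nonneg _
            rw [hx, ← EReal.coe_add] at h3
            have h3' : 0 ≤ c + y := by exact_mod_cast h3
            rw [← EReal.coe_neg, EReal.toENNReal_of_ne_top (EReal.coe_ne_top _), EReal.toReal_coe]
            exact ENNReal.ofReal_le_ofReal (by linarith)
      _ = _ := by simp
  unfold eintegral
  generalize ∫⁻ x, (-f x).toENNReal ∂μ = B at *
  generalize ∫⁻ x, (f x).toENNReal ∂μ = F at *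
  generalize ∫⁻ x, g x ∂μ = G at *
  have hBt : B ≠ ⊤ := ne_top_of_le_ne_top ENNReal.ofReal_ne_top hB
  lift B to NNReal using hBt
  have hce : ((ENNReal.ofReal c : ℝ≥0∞) : EReal) = c := by
    rw [EReal.coe_ennreal_ofReal, max_eq_left hc]
  by_cases hG : G = ⊤
  · have hF : F = ⊤ := by
      by_contra hF
      rw [hG, top_add] at hint
      exact ENNReal.add_ne_top.2 ⟨hF, ENNReal.ofReal_ne_top⟩ hint.symm
    rw [hF, hG, EReal.coe_ennreal_top, EReal.top_sub_coe]
    exact EReal.top_sub_coe (B : ℝ)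
  · have hF : F ≠ ⊤ := by
      rintro rfl
      rw [top_add] at hint
      exact ENNReal.add_ne_top.2 ⟨hG, ENNReal.coe_ne_top⟩ hint
    lift G to NNReal using hG
    lift F to NNReal using hF
    have h5 : (G : ℝ) + B = F + c := by
      have := congrArg ENNReal.toReal hint
      rw [ENNReal.toReal_add (by simp) (by simp), ENNReal.toReal_add (by simp) (by simp),
        ENNReal.toReal_ofReal hc] at this
      simpa using this
    have e : ∀ x : NNReal, (((x : ℝ≥0∞)) : EReal) = ((x : ℝ) : EReal) := fun x => rfl
    rw [e, e, e, ← EReal.coe_sub, ← EReal.coe_sub]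
    congr 1; linarith

theorem ae_mem_of_mem_probMeasuresOn {K : Set ℂ} {ν : Measure ℂ} (h : ν ∈ probMeasuresOn K) :
    ∀ᵐ z ∂ν, z ∈ K := by
  rw [ae_iff]; exact h.2

theorem logPotential_eq {ν : Measure ℂ} [IsProbabilityMeasure ν] {R : ℝ} (hR : 1 ≤ R) {z : ℂ}
    (h : ∀ᵐ w ∂ν, ‖z - w‖ ≤ R) :
    logPotential ν z = posPot R ν z - (Real.log R : EReal) :=
  eintegral_eq_lintegral_sub ν (Real.log_nonneg hR) (measurable_posKernel_right R z)
    (h.mono fun _ hw => posKernel_toEReal (by linarith) hw)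

/-- Once `R` dominates the diameter of `K`, minimizing `logEnergy` over `K` amounts to minimizing
the nonnegative `posEnergy R`. -/
theorem logEnergy_eq {K : Set ℂ} {ν : Measure ℂ} (hν : ν ∈ probMeasuresOn K) {R : ℝ}
    (hR : 1 ≤ R) (h : ∀ z ∈ K, ∀ w ∈ K, ‖z - w‖ ≤ R) :
    logEnergy ν = posEnergy R ν ν - (Real.log R : EReal) := by
  have := hν.1
  have hae := ae_mem_of_mem_probMeasuresOn hν
  have hprod : ∀ᵐ p ∂(ν.prod ν), p.1 ∈ K ∧ p.2 ∈ K := by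
    have h1 : ∀ᵐ p ∂(ν.prod ν), p.1 ∈ K := Measure.quasiMeasurePreserving_fst.ae hae
    have h2 : ∀ᵐ p ∂(ν.prod ν), p.2 ∈ K := Measure.quasiMeasurePreserving_snd.ae hae
    exact h1.and h2
  have hm := measurable_posKernel R
  rw [logEnergy, eintegral_eq_lintegral_sub (ν.prod ν) (Real.log_nonneg hR) hm
    (hprod.mono fun p hp => posKernel_toEReal (by linarith) (h _ hp.1 _ hp.2)),
    lintegral_prod _ hm.aemeasurable]
  rfl

/-! ### Finite potentials as Bochner integrals of the logarithm -/

theorem measure_singleton_eq_zero_of_posPot_ne_top {ν : Measure ℂ} {R : ℝ} (hR : 0 < R) {z : ℂ}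
    (h : posPot R ν z ≠ ∞) : ν {z} = 0 := by
  have h1 : ∀ᵐ w ∂ν, posKernel R z w < ∞ := ae_lt_top (measurable_posKernel_right R z) h
  refine measure_mono_null ?_ (ae_iff.1 h1)
  rintro w rfl
  simp [posKernel_self hR]

theorem posKernel_eq_ofReal_sub {R : ℝ} (hR : 0 < R) {z w : ℂ} (h : z ≠ w) :
    posKernel R z w = ENNReal.ofReal (Real.log R - Real.log ‖z - w‖) := by
  rw [posKernel_eq_ofReal hR h,
    Real.log_div hR.ne' (norm_pos_iff.2 (sub_ne_zero.2 h)).ne']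

theorem log_norm_le_log_of_norm_le {R : ℝ} (hR : 1 ≤ R) {z : ℂ} (h : ‖z‖ ≤ R) :
    Real.log ‖z‖ ≤ Real.log R := by
  rcases eq_or_ne z 0 with rfl | hz
  · simpa using Real.log_nonneg hR
  · exact Real.log_le_log (norm_pos_iff.2 hz) h

theorem lintegral_ofReal_const_sub {α : Type*} [MeasurableSpace α] {μ : Measure α}
    [IsProbabilityMeasure μ] {f : α → ℝ} (hf : Integrable f μ) {c : ℝ} (h : ∀ᵐ x ∂μ, f x ≤ c) :
    ∫⁻ x, ENNReal.ofReal (c - f x) ∂μ = ENNReal.ofReal (c - ∫ x, f x ∂μ) := by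
  have hi : Integrable (fun x => c - f x) μ := (integrable_const c).sub hf
  rw [← ofReal_integral_eq_lintegral_ofReal hi (h.mono fun x hx => by simpa using hx),
    integral_sub (integrable_const c) hf]
  simp

theorem ae_ne_of_posPot_ne_top {ν : Measure ℂ} {R : ℝ} (hR : 0 < R) {z : ℂ}
    (h : posPot R ν z ≠ ∞) : ∀ᵐ w ∂ν, z ≠ w := by
  have := measure_singleton_eq_zero_of_posPot_ne_top hR h
  rw [ae_iff]
  convert this using 2
  ext w; simp [eq_comm]

theorem integrable_log_norm_of_posPot_ne_top {ν : Measure ℂ} [IsProbabilityMeasure ν] {R : ℝ}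
    (hR : 1 ≤ R) {z : ℂ} (hle : ∀ᵐ w ∂ν, ‖z - w‖ ≤ R) (h : posPot R ν z ≠ ∞) :
    Integrable (fun w => Real.log ‖z - w‖) ν := by
  have hR0 : 0 < R := by linarith
  have h1 : Integrable (fun w => (posKernel R z w).toReal) ν :=
    integrable_toReal_of_lintegral_ne_top (measurable_posKernel_right R z).aemeasurable h
  refine ((integrable_const (Real.log R)).sub h1).congr ?_
  filter_upwards [hle, ae_ne_of_posPot_ne_top hR0 h] with w hw hzw
  rw [Pi.sub_apply, posKernel_eq_ofReal_sub hR0 hzw,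
    ENNReal.toReal_ofReal (sub_nonneg.2 (log_norm_le_log_of_norm_le hR hw))]
  ring

theorem posPot_eq_ofReal {ν : Measure ℂ} [IsProbabilityMeasure ν] {R : ℝ}
    (hR : 1 ≤ R) {z : ℂ} (hle : ∀ᵐ w ∂ν, ‖z - w‖ ≤ R) (h : posPot R ν z ≠ ∞) :
    posPot R ν z = ENNReal.ofReal (Real.log R - ∫ w, Real.log ‖z - w‖ ∂ν) := by
  have hR0 : 0 < R := by linarith
  rw [← lintegral_ofReal_const_sub (integrable_log_norm_of_posPot_ne_top hR hle h)
    (hle.mono fun w hw => log_norm_le_log_of_norm_le hR hw)]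
  refine lintegral_congr_ae ?_
  filter_upwards [ae_ne_of_posPot_ne_top hR0 h] with w hzw
  exact posKernel_eq_ofReal_sub hR0 hzw

theorem integral_log_norm_le {ν : Measure ℂ} [IsProbabilityMeasure ν] {R : ℝ}
    (hR : 1 ≤ R) {z : ℂ} (hle : ∀ᵐ w ∂ν, ‖z - w‖ ≤ R) :
    ∫ w, Real.log ‖z - w‖ ∂ν ≤ Real.log R := by
  by_cases hi : Integrable (fun w => Real.log ‖z - w‖) ν
  · calc _ ≤ ∫ _w, Real.log R ∂ν := integral_mono_ae hi (integrable_const _)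
          (hle.mono fun w hw => log_norm_le_log_of_norm_le hR hw)
      _ = _ := by simp
  · rw [integral_undef hi]; exact Real.log_nonneg hR

/-- At points with finite potential, `logPotential` is the Bochner integral. -/
theorem logPotential_eq_coe {ν : Measure ℂ} [IsProbabilityMeasure ν] {R : ℝ}
    (hR : 1 ≤ R) {z : ℂ} (hle : ∀ᵐ w ∂ν, ‖z - w‖ ≤ R) (h : posPot R ν z ≠ ∞) :
    logPotential ν z = ((-∫ w, Real.log ‖z - w‖ ∂ν : ℝ) : EReal) := by
  rw [logPotential_eq hR hle, posPot_eq_ofReal hR hle h, EReal.coe_ennreal_ofReal,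
    max_eq_left (sub_nonneg.2 (integral_log_norm_le hR hle)), ← EReal.coe_sub]
  congr 1; ring

/-- The potential is finite away from the support. -/
theorem posPot_ne_top_of_le_norm {ν : Measure ℂ} [IsFiniteMeasure ν] {R d : ℝ} (hR : 0 < R)
    (hd : 0 < d) {z : ℂ} (h : ∀ᵐ w ∂ν, d ≤ ‖z - w‖) : posPot R ν z ≠ ∞ := by
  refine ne_top_of_le_ne_top (b := ∫⁻ _w, ENNReal.ofReal (Real.log (R / d)) ∂ν) ?_ ?_
  · rw [lintegral_const]
    exact ENNReal.mul_ne_top ENNReal.ofReal_ne_top (measure_ne_top _ _)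
  · refine lintegral_mono_ae (h.mono fun w hw => ?_)
    have hzw : z ≠ w := by
      rintro rfl; simp at hw; linarith
    have h0 : 0 < ‖z - w‖ := by linarith
    rw [posKernel_eq_ofReal hR hzw]
    gcongr

/-! ### Existence of minimizers -/

/-- The integral is the supremum over `n` of the integrals of the bounded continuous functions `min
f n`, each of which is weakly continuous in the measure. -/
theorem lowerSemicontinuous_lintegral_probabilityMeasure {X : Type*} [TopologicalSpace X]
    [MeasurableSpace X] [OpensMeasurableSpace X] {f : X → ℝ≥0∞} (hf : Continuous f) :
    LowerSemicontinuous (fun ν : ProbabilityMeasure X => ∫⁻ x, f x ∂(ν : Measure X)) := by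
  have hsup : ∀ ν : ProbabilityMeasure X, ∫⁻ x, f x ∂(ν : Measure X) =
      ⨆ n : ℕ, ∫⁻ x, min (f x) n ∂(ν : Measure X) := by
    intro ν
    rw [← lintegral_iSup]
    · congr 1; ext x
      apply le_antisymm
      · rcases eq_or_ne (f x) ⊤ with h | h
        · simp [h, ENNReal.iSup_natCast]
        · obtain ⟨n, hn⟩ := ENNReal.exists_nat_gt h
          exact le_iSup_of_le n (by simp [hn.le])
      · exact iSup_le fun n => min_le_left _ _
    · intro n
      exact (hf.min continuous_const).measurable
    · intro m n hmn x
      dsimp only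
      gcongr
  simp_rw [hsup]
  refine lowerSemicontinuous_iSup fun n => Continuous.lowerSemicontinuous ?_
  have hne : ∀ x, min (f x) n ≠ ⊤ := fun x =>
    ne_top_of_le_ne_top (ENNReal.natCast_ne_top n) (min_le_right _ _)
  let g : BoundedContinuousFunction X NNReal := BoundedContinuousFunction.mkOfBound
    ⟨fun x => (min (f x) n).toNNReal,
      ENNReal.continuousOn_toNNReal.comp_continuous (hf.min continuous_const) hne⟩ n (by
        intro x y
        have hb : ∀ x, (min (f x) n).toNNReal ≤ n := fun x => by
          have := ENNReal.toNNReal_mono (ENNReal.natCast_ne_top n) (min_le_right (f x) n)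
          simpa using this
        have hx := hb x
        have hy := hb y
        rw [NNReal.dist_eq, abs_le]
        have hx' : ((min (f x) n).toNNReal : ℝ) ≤ n := by exact_mod_cast hx
        have hy' : ((min (f y) n).toNNReal : ℝ) ≤ n := by exact_mod_cast hy
        have := NNReal.coe_nonneg (min (f x) n).toNNReal
        have := NNReal.coe_nonneg (min (f y) n).toNNReal
        constructor <;> simp only [ContinuousMap.coe_mk] <;> linarith)
  rw [continuous_iff_continuousAt]
  intro ν
  have := (ProbabilityMeasure.tendsto_iff_forall_lintegral_tendsto.1
    (tendsto_id (x := 𝓝 ν))) g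
  have hg : ∀ x, ((g x : NNReal) : ℝ≥0∞) = min (f x) n := fun x => ENNReal.coe_toNNReal (hne x)
  simpa only [hg, id, ContinuousAt] using this

/-- The direct method: probability measures on the compact space `K` form a compact space, `ν ↦ ν ×
ν` is weakly continuous, and the energy is lower semicontinuous. Measures on the subtype are
identified with measures on the plane carried by `K`. -/
theorem exists_isEquilibriumMeasure {K : Set ℂ} (hK : IsCompact K) (hne : K.Nonempty) :
    ∃ ν, IsEquilibriumMeasure K ν := by
  obtain ⟨R, hR1, hR⟩ : ∃ R : ℝ, 1 ≤ R ∧ ∀ z ∈ K, ∀ w ∈ K, ‖z - w‖ ≤ R := by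
    obtain ⟨C, hC⟩ := Metric.isBounded_iff.1 hK.isBounded
    exact ⟨max 1 C, le_max_left _ _, fun z hz w hw => by
      rw [← dist_eq_norm]; exact (hC hz hw).trans (le_max_right _ _)⟩
  have : CompactSpace K := isCompact_iff_compactSpace.1 hK
  have : Nonempty K := hne.to_subtype
  obtain ⟨z0⟩ := ‹Nonempty K›
  have : Nonempty (ProbabilityMeasure K) := ⟨⟨Measure.dirac z0, inferInstance⟩⟩
  let F : ProbabilityMeasure K → ℝ≥0∞ := fun ν =>
    ∫⁻ p, posKernel R (p.1 : ℂ) (p.2 : ℂ) ∂((ν.prod ν : ProbabilityMeasure (K × K)) : Measure (K × K))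
  have hF : LowerSemicontinuous F := by
    have hc : Continuous (fun p : K × K => posKernel R (p.1 : ℂ) (p.2 : ℂ)) :=
      (continuous_posKernel R).comp (f := fun p : K × K => ((p.1 : ℂ), (p.2 : ℂ))) (by fun_prop)
    exact (lowerSemicontinuous_lintegral_probabilityMeasure hc).comp
      (ProbabilityMeasure.continuous_prod.comp (continuous_id.prodMk continuous_id))
  obtain ⟨ν, -, hν⟩ := (hF.lowerSemicontinuousOn univ).exists_isMinOn univ_nonempty isCompact_univ
  have hmv : MeasurableEmbedding (Subtype.val : K → ℂ) :=
    MeasurableEmbedding.subtype_coe hK.measurableSet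
  have hFe : ∀ ρ : ProbabilityMeasure K, F ρ =
      posEnergy R ((ρ : Measure K).map Subtype.val) ((ρ : Measure K).map Subtype.val) := by
    intro ρ
    have hm := measurable_posKernel R
    simp only [F, posEnergy, posPot]
    rw [hmv.lintegral_map]
    simp_rw [hmv.lintegral_map]
    rw [ProbabilityMeasure.toMeasure_prod, lintegral_prod]
    exact (hm.comp (f := fun p : K × K => ((p.1 : ℂ), (p.2 : ℂ))) (by fun_prop)).aemeasurable
  have hmem : ∀ ρ : ProbabilityMeasure K, (ρ : Measure K).map Subtype.val ∈ probMeasuresOn K := by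
    intro ρ
    refine ⟨Measure.isProbabilityMeasure_map hmv.measurable.aemeasurable, ?_⟩
    rw [hmv.map_apply]
    simp
  refine ⟨(ν : Measure K).map Subtype.val, hmem ν, fun μ hμ => ?_⟩
  have := hμ.1
  have hmap : (μ.comap (Subtype.val : K → ℂ)).map Subtype.val = μ := by
    rw [map_comap_subtype_coe hK.measurableSet]
    exact Measure.restrict_eq_self_of_ae_mem (ae_mem_of_mem_probMeasuresOn hμ)
  have hprob : IsProbabilityMeasure (μ.comap (Subtype.val : K → ℂ)) := by
    constructor
    rw [hmv.comap_apply, image_univ, Subtype.range_coe]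
    exact (prob_compl_eq_zero_iff hK.measurableSet).1 hμ.2
  obtain ⟨ρ, hρ⟩ : ∃ ρ : ProbabilityMeasure K, (ρ : Measure K) = μ.comap Subtype.val :=
    ⟨⟨_, hprob⟩, rfl⟩
  have hmin : F ν ≤ F ρ := hν (mem_univ _)
  rw [hFe, hFe, hρ, hmap] at hmin
  rw [logEnergy_eq (hmem ν) hR1 hR, logEnergy_eq hμ hR1 hR]
  exact EReal.sub_le_sub (EReal.coe_ennreal_le_coe_ennreal_iff.2 hmin) le_rfl

/-! ### Mean values and the maximum principle for potentials -/

/-- The Bochner integral `∫ log |z - w| dν(w)`. -/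
def logMean (ν : Measure ℂ) (z : ℂ) : ℝ := ∫ w, Real.log ‖z - w‖ ∂ν

theorem measurable_log_norm_sub (z : ℂ) : Measurable (fun w : ℂ => Real.log ‖z - w‖) := by
  fun_prop

theorem log_sub_log_le_div {a b : ℝ} (ha : 0 < a) (hb : 0 < b) :
    Real.log a - Real.log b ≤ (a - b) / b := by
  rw [← Real.log_div ha.ne' hb.ne', sub_div, div_self hb.ne']
  linarith [Real.log_le_sub_one_of_pos (div_pos ha hb)]

theorem log_norm_sub_le_add_div {z z' w : ℂ} {d : ℝ} (hd : 0 < d) (h : d ≤ ‖z - w‖)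
    (h' : d ≤ ‖z' - w‖) : Real.log ‖z' - w‖ ≤ Real.log ‖z - w‖ + ‖z' - z‖ / d := by
  have h1 := log_sub_log_le_div (hd.trans_le h') (hd.trans_le h)
  have h2 : ‖z' - w‖ - ‖z - w‖ ≤ ‖z' - z‖ := by
    have := norm_sub_norm_le (z' - w) (z - w)
    simpa using this
  have h3 : (‖z' - w‖ - ‖z - w‖) / ‖z - w‖ ≤ ‖z' - z‖ / d := by
    have := hd.trans_le h
    gcongr
  linarith

theorem integrable_log_norm_of_le {ν : Measure ℂ} [IsFiniteMeasure ν] {z : ℂ} {d D : ℝ}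
    (hd : 0 < d) (h : ∀ᵐ w ∂ν, d ≤ ‖z - w‖) (hD : ∀ᵐ w ∂ν, ‖z - w‖ ≤ D) :
    Integrable (fun w => Real.log ‖z - w‖) ν := by
  refine Integrable.of_bound (measurable_log_norm_sub z).aestronglyMeasurable
    (max |Real.log d| |Real.log D|) ?_
  filter_upwards [h, hD] with w h1 h2
  have h0 := hd.trans_le h1
  rw [Real.norm_eq_abs]
  exact abs_le_max_abs_abs (Real.log_le_log hd h1) (Real.log_le_log h0 h2)

theorem ae_norm_sub_le {ν : Measure ℂ} {S : Set ℂ} (hS : IsCompact S) (hν : ∀ᵐ w ∂ν, w ∈ S)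
    (z : ℂ) : ∃ D : ℝ, ∀ᵐ w ∂ν, ‖z - w‖ ≤ D := by
  obtain ⟨C, hC⟩ := hS.isBounded.exists_norm_le
  exact ⟨‖z‖ + C, hν.mono fun w hw => (norm_sub_le _ _).trans (by gcongr; exact hC w hw)⟩

theorem exists_pos_le_norm_sub {S : Set ℂ} (hS : IsCompact S) {z : ℂ} (hz : z ∉ S) :
    ∃ d > 0, ∀ w ∈ S, d ≤ ‖z - w‖ := by
  obtain ⟨d, hd, hb⟩ := Metric.isOpen_iff.1 hS.isClosed.isOpen_compl z hz
  refine ⟨d, hd, fun w hw => ?_⟩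
  by_contra hlt
  exact hb (by rw [Metric.mem_ball, dist_comm, dist_eq_norm]; linarith) hw

theorem integrable_log_norm_of_notMem {ν : Measure ℂ} [IsFiniteMeasure ν] {S : Set ℂ}
    (hS : IsCompact S) (hν : ∀ᵐ w ∂ν, w ∈ S) {z : ℂ} (hz : z ∉ S) :
    Integrable (fun w => Real.log ‖z - w‖) ν := by
  obtain ⟨d, hd, h⟩ := exists_pos_le_norm_sub hS hz
  obtain ⟨D, hD⟩ := ae_norm_sub_le hS hν z
  exact integrable_log_norm_of_le hd (hν.mono h) hD

theorem logMean_le_add_div {ν : Measure ℂ} [IsProbabilityMeasure ν] {S : Set ℂ}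
    (hS : IsCompact S) (hν : ∀ᵐ w ∂ν, w ∈ S) {z z' : ℂ} {d : ℝ} (hd : 0 < d)
    (h : ∀ w ∈ S, d ≤ ‖z - w‖) (h' : ∀ w ∈ S, d ≤ ‖z' - w‖) :
    logMean ν z' ≤ logMean ν z + ‖z' - z‖ / d := by
  have hi : ∀ z : ℂ, (∀ w ∈ S, d ≤ ‖z - w‖) → Integrable (fun w => Real.log ‖z - w‖) ν := by
    intro z hz
    obtain ⟨D, hD⟩ := ae_norm_sub_le hS hν z
    exact integrable_log_norm_of_le hd (hν.mono hz) hD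
  calc logMean ν z' ≤ ∫ w, (Real.log ‖z - w‖ + ‖z' - z‖ / d) ∂ν :=
        integral_mono_ae (hi z' h') ((hi z h).add (integrable_const _))
          (hν.mono fun w hw => log_norm_sub_le_add_div hd (h w hw) (h' w hw))
    _ = _ := by
        rw [integral_add (hi z h) (integrable_const _)]
        simp [logMean]

theorem continuousOn_logMean {ν : Measure ℂ} [IsProbabilityMeasure ν] {S : Set ℂ}
    (hS : IsCompact S) (hν : ∀ᵐ w ∂ν, w ∈ S) : ContinuousOn (logMean ν) Sᶜ := by
  refine continuousOn_of_forall_continuousAt fun z hz => ?_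
  obtain ⟨d, hd, h⟩ := exists_pos_le_norm_sub hS hz
  rw [Metric.continuousAt_iff]
  intro ε hε
  refine ⟨min (d / 2) (ε * (d / 2)), by positivity, fun z' hz' => ?_⟩
  rw [dist_eq_norm] at hz'
  have h1 : ∀ w ∈ S, d / 2 ≤ ‖z' - w‖ := fun w hw => by
    have := h w hw
    have h3 : ‖z - w‖ ≤ ‖z' - z‖ + ‖z' - w‖ := by
      rw [norm_sub_rev z' z]; exact norm_sub_le_norm_sub_add_norm_sub z z' w
    linarith [hz'.trans_le (min_le_left _ _)]
  have h2 : ∀ w ∈ S, d / 2 ≤ ‖z - w‖ := fun w hw => by linarith [h w hw]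
  have ha := logMean_le_add_div hS hν (by positivity : 0 < d / 2) h2 h1
  have hb := logMean_le_add_div hS hν (by positivity : 0 < d / 2) h1 h2
  rw [norm_sub_rev] at hb
  have hlt : ‖z' - z‖ / (d / 2) < ε := by
    rw [div_lt_iff₀ (by positivity)]
    exact hz'.trans_le (min_le_right _ _)
  rw [Real.dist_eq, abs_lt]
  constructor <;> linarith

/-- The mean value property of logarithmic potentials off the support. -/
theorem circleAverage_logMean {ν : Measure ℂ} [IsProbabilityMeasure ν] {S : Set ℂ}
    (hS : IsCompact S) (hν : ∀ᵐ w ∂ν, w ∈ S) {z : ℂ} {ρ d : ℝ} (hρ : 0 < ρ) (hd : ρ < d)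
    (h : ∀ w ∈ S, d ≤ ‖z - w‖) : Real.circleAverage (logMean ν) z ρ = logMean ν z := by
  obtain ⟨D, hD⟩ := ae_norm_sub_le hS hν z
  have hint : Integrable (Function.uncurry fun (θ : ℝ) (w : ℂ) => Real.log ‖circleMap z ρ θ - w‖)
      ((volume.restrict (uIoc 0 (2 * Real.pi))).prod ν) := by
    have hfin : IsFiniteMeasure (volume.restrict (uIoc 0 (2 * Real.pi))) := by
      rw [uIoc_of_le Real.two_pi_pos.le]; infer_instance
    have hm : Measurable (Function.uncurry fun (θ : ℝ) (w : ℂ) =>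
        Real.log ‖circleMap z ρ θ - w‖) := by
      have : Measurable (circleMap z ρ) := (continuous_circleMap z ρ).measurable
      unfold Function.uncurry
      fun_prop
    refine Integrable.of_bound hm.aestronglyMeasurable
      (max |Real.log (d - ρ)| |Real.log (D + ρ)|) ?_
    have h2 : ∀ᵐ p ∂((volume.restrict (uIoc 0 (2 * Real.pi))).prod ν), p.2 ∈ S ∧ ‖z - p.2‖ ≤ D :=
      Measure.quasiMeasurePreserving_snd.ae (hν.and hD)
    filter_upwards [h2] with p hp
    have h3 := h p.2 hp.1
    have h4 : ‖circleMap z ρ p.1 - z‖ = ρ := by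
      simp [circleMap, abs_of_pos hρ]
    have h5 : ‖circleMap z ρ p.1 - p.2‖ ≤ D + ρ := by
      have := norm_sub_le_norm_sub_add_norm_sub (circleMap z ρ p.1) z p.2
      linarith [hp.2]
    have h6 : d - ρ ≤ ‖circleMap z ρ p.1 - p.2‖ := by
      have := norm_sub_le_norm_sub_add_norm_sub z (circleMap z ρ p.1) p.2
      rw [norm_sub_rev z (circleMap z ρ p.1)] at this
      linarith
    have h7 : 0 < d - ρ := by linarith
    rw [Real.norm_eq_abs]
    exact abs_le_max_abs_abs (Real.log_le_log h7 h6) (Real.log_le_log (h7.trans_le h6) h5)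
  -- The average of `log |· - w|` over the circle is `log ρ + log⁺ (|z - w| / ρ)`, which equals `log
  -- |z - w|` because `|z - w| ≥ d > ρ`.
  have key : ∀ᵐ w ∂ν, (2 * Real.pi)⁻¹ * ∫ θ in (0 : ℝ)..2 * Real.pi,
      Real.log ‖circleMap z ρ θ - w‖ = Real.log ‖z - w‖ := by
    filter_upwards [hν] with w hw
    have h1 := circleAverage_log_norm_sub_const_eq_log_radius_add_posLog (a := w) (c := z) hρ.ne'
    rw [Real.circleAverage_def, smul_eq_mul] at h1
    have h3 := h w hw
    rw [h1, Real.posLog_eq_log, Real.log_mul (by positivity) (by linarith), Real.log_inv]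
    · ring
    · rw [abs_of_nonneg (by positivity), inv_mul_eq_div, one_le_div hρ]
      linarith
  rw [Real.circleAverage_def, smul_eq_mul]
  unfold logMean
  rw [intervalIntegral_integral_swap hint, ← integral_const_mul]
  exact integral_congr_ae key

/-- Compare `z` with a nearest point `b` of `S`. For `w ∈ S` always `|b - w| ≤ 2 |z - w|`, which
costs `log 2` on a neighbourhood `U` of `a`; as `a` carries no mass, `U` can be given small measure.
Away from `U` the two logarithms are close. -/
theorem exists_ball_le_logMean {ν : Measure ℂ} [IsProbabilityMeasure ν] {S : Set ℂ}
    (hS : IsCompact S) (hν : ∀ᵐ w ∂ν, w ∈ S) {m : ℝ}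
    (hm : ∀ z ∈ S, Integrable (fun w => Real.log ‖z - w‖) ν ∧ ν {z} = 0 ∧ m ≤ logMean ν z)
    {a : ℂ} (ha : a ∈ S) {ε : ℝ} (hε : 0 < ε) :
    ∃ δ > 0, ∀ z ∉ S, ‖z - a‖ < δ → m - ε ≤ logMean ν z := by
  have hlog2 : 0 < Real.log 2 := Real.log_pos (by norm_num)
  obtain ⟨U, hU, hUo, hUν⟩ := Set.exists_isOpen_lt_of_lt {a}
    (ENNReal.ofReal (ε / (2 * Real.log 2))) (μ := ν) (by
      rw [(hm a ha).2.1, ENNReal.ofReal_pos]; positivity)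
  obtain ⟨r, hr, hrU⟩ := Metric.isOpen_iff.1 hUo a (hU rfl)
  -- The bound `r / 2` keeps `z` at distance at least `r / 2` from points outside `U`; then `(ε r /
  -- 4) / (r / 2) = ε / 2` bounds the change of the logarithm there.
  refine ⟨min (r / 2) (ε * r / 4), by positivity, fun z hz hza => ?_⟩
  set δ := min (r / 2) (ε * r / 4)
  obtain ⟨b, hb, hbz⟩ := hS.exists_infDist_eq_dist ⟨a, ha⟩ z
  have hnear : ∀ w ∈ S, ‖z - b‖ ≤ ‖z - w‖ := fun w hw => by
    rw [← dist_eq_norm, ← dist_eq_norm, ← hbz]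
    exact Metric.infDist_le_dist_of_mem hw
  have hpos : 0 < ‖z - b‖ := norm_pos_iff.2 (sub_ne_zero.2 fun h => hz (h ▸ hb))
  have hiz := integrable_log_norm_of_notMem hS hν hz
  have hbb := hm b hb
  have hne : ∀ᵐ w ∂ν, b ≠ w := by
    rw [ae_iff]
    convert hbb.2.1 using 2
    ext w; simp [eq_comm]
  have hpt : ∀ᵐ w ∂ν, Real.log ‖b - w‖ ≤
      Real.log ‖z - w‖ + (U.indicator (fun _ => Real.log 2) w + ε / 2) := by
    filter_upwards [hν, hne] with w hw hbw
    have hzw : 0 < ‖z - w‖ := hpos.trans_le (hnear w hw)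
    have hbw' : 0 < ‖b - w‖ := norm_pos_iff.2 (sub_ne_zero.2 hbw)
    have htri : ‖b - w‖ ≤ ‖z - b‖ + ‖z - w‖ := by
      rw [norm_sub_rev z b]; exact norm_sub_le_norm_sub_add_norm_sub b z w
    by_cases hwU : w ∈ U
    · rw [indicator_of_mem hwU]
      have h1 : Real.log ‖b - w‖ ≤ Real.log (2 * ‖z - w‖) :=
        Real.log_le_log hbw' (by linarith [hnear w hw])
      rw [Real.log_mul two_ne_zero hzw.ne'] at h1
      linarith
    · rw [indicator_of_notMem hwU]
      have h1 : r ≤ ‖a - w‖ := by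
        by_contra hlt
        exact hwU (hrU (by rw [Metric.mem_ball, dist_comm, dist_eq_norm]; linarith))
      have h2 : ‖a - w‖ ≤ ‖z - a‖ + ‖z - w‖ := by
        rw [norm_sub_rev z a]; exact norm_sub_le_norm_sub_add_norm_sub a z w
      have h3 : r / 2 ≤ ‖z - w‖ := by
        linarith [hza.trans_le (min_le_left _ _)]
      have h4 := log_sub_log_le_div hbw' hzw
      have h5 : (‖b - w‖ - ‖z - w‖) / ‖z - w‖ ≤ (ε * r / 4) / (r / 2) := by
        have : ‖b - w‖ - ‖z - w‖ ≤ ε * r / 4 := by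
          linarith [hnear a ha, hza.trans_le (min_le_right _ _)]
        gcongr
      have h6 : (ε * r / 4) / (r / 2) = ε / 2 := by field_simp; ring
      linarith
  have hUi : Integrable (U.indicator (fun _ => Real.log 2)) ν :=
    (integrable_const _).indicator hUo.measurableSet
  have hsum : Integrable (fun w => U.indicator (fun _ => Real.log 2) w + ε / 2) ν :=
    hUi.add (integrable_const _)
  have h1 : logMean ν b ≤ logMean ν z + (Real.log 2 * ν.real U + ε / 2) := by
    calc logMean ν b ≤ ∫ w, (Real.log ‖z - w‖ +
          (U.indicator (fun _ => Real.log 2) w + ε / 2)) ∂ν :=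
          integral_mono_ae hbb.1 (hiz.add hsum) hpt
      _ = _ := by
        rw [integral_add hiz hsum,
          integral_add hUi (integrable_const _), integral_indicator_const _ hUo.measurableSet]
        simp [logMean, mul_comm]
  have h2 : ν.real U ≤ ε / (2 * Real.log 2) :=
    ENNReal.toReal_le_of_le_ofReal (by positivity) hUν.le
  have h3 : Real.log 2 * ν.real U ≤ ε / 2 := by
    calc _ ≤ Real.log 2 * (ε / (2 * Real.log 2)) := by gcongr
      _ = _ := by field_simp
  linarith [hbb.2.2]

/-- The maximum principle for logarithmic potentials (Maria's theorem): a lower bound for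
`∫ log |z - w| dν(w)` on a compact set carrying `ν` holds everywhere. -/
theorem le_logMean_of_forall_mem {ν : Measure ℂ} [IsProbabilityMeasure ν] {S : Set ℂ}
    (hS : IsCompact S) (hν : ∀ᵐ w ∂ν, w ∈ S) {m : ℝ}
    (hm : ∀ z ∈ S, Integrable (fun w => Real.log ‖z - w‖) ν ∧ ν {z} = 0 ∧ m ≤ logMean ν z)
    (z : ℂ) : m ≤ logMean ν z := by
  by_cases hzS : z ∈ S
  · exact (hm z hzS).2.2
  by_contra! hlt
  set ε := (m - logMean ν z) / 2 with hεdef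
  have hε : 0 < ε := by simp only [hεdef]; linarith
  have hcont := continuousOn_logMean hS hν
  let A : Set ℂ := {x | x ∉ S ∧ logMean ν x ≤ m - ε}
  have hzA : z ∈ A := ⟨hzS, by simp only [hεdef]; linarith⟩
  -- Off `S` this is continuity; `exists_ball_le_logMean` prevents `A` from accumulating at points
  -- of `S`.
  have hAclosed : IsClosed A := by
    rw [← isOpen_compl_iff, Metric.isOpen_iff]
    intro x hx
    by_cases hxS : x ∈ S
    · obtain ⟨δ, hδ, h⟩ := exists_ball_le_logMean hS hν hm hxS (half_pos hε)
      refine ⟨δ, hδ, fun y hy hyA => ?_⟩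
      have := h y hyA.1 (by rwa [← dist_eq_norm])
      linarith [hyA.2]
    · have hlt' : m - ε < logMean ν x := by
        by_contra hle
        exact hx ⟨hxS, not_lt.1 hle⟩
      have hca : ContinuousAt (logMean ν) x :=
        hcont.continuousAt (hS.isClosed.isOpen_compl.mem_nhds hxS)
      obtain ⟨δ, hδ, h⟩ := Metric.eventually_nhds_iff_ball.1 (hca.eventually_const_lt hlt')
      exact ⟨δ, hδ, fun y hy hyA => absurd (h y hy) (not_lt.2 hyA.2)⟩
  have hAbdd : Bornology.IsBounded A := by
    obtain ⟨C, hC⟩ := hS.isBounded.exists_norm_le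
    -- Beyond this radius every point of `S` is at distance at least `exp m`, so the mean is at
    -- least `m`.
    refine (Metric.isBounded_closedBall (x := (0 : ℂ)) (r := C + Real.exp m)).subset ?_
    intro x hx
    rw [mem_closedBall_zero_iff]
    by_contra! hgt
    have h1 : ∀ᵐ w ∂ν, m ≤ Real.log ‖x - w‖ := by
      filter_upwards [hν] with w hw
      have h2 : Real.exp m ≤ ‖x - w‖ := by
        have := norm_sub_norm_le x w
        linarith [hC w hw]
      rw [← Real.log_exp m]
      exact Real.log_le_log (Real.exp_pos m) h2
    have h3 : m ≤ logMean ν x := by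
      calc m = ∫ _w, m ∂ν := by simp
        _ ≤ _ := integral_mono_ae (integrable_const _)
          (integrable_log_norm_of_notMem hS hν hx.1) h1
    linarith [hx.2]
  have hAc : IsCompact A := Metric.isCompact_of_isClosed_isBounded hAclosed hAbdd
  have hcA : ContinuousOn (logMean ν) A := hcont.mono fun x hx => hx.1
  obtain ⟨x, hxA, hxmin⟩ := hAc.exists_isMinOn ⟨z, hzA⟩ hcA
  have hmin : ∀ y ∉ S, logMean ν x ≤ logMean ν y := by
    intro y hy
    by_cases hyA : y ∈ A
    · exact hxmin hyA
    · have : m - ε < logMean ν y := by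
        by_contra hle
        exact hyA ⟨hy, not_lt.1 hle⟩
      linarith [hxA.2]
  let B : Set ℂ := A ∩ {y | logMean ν y ≤ logMean ν x}
  have hBc : IsCompact B := by
    refine hAc.of_isClosed_subset ?_ inter_subset_left
    exact hcA.preimage_isClosed_of_isClosed hAclosed (isClosed_Iic (a := logMean ν x))
  -- A rightmost minimum point: the rightmost point of a small circle around it is not a minimum,
  -- which contradicts the mean value property.
  obtain ⟨y, hyB, hymax⟩ := hBc.exists_isMaxOn ⟨x, hxA, le_refl (logMean ν x)⟩
    Complex.continuous_re.continuousOn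
  have hyx : logMean ν y = logMean ν x := le_antisymm hyB.2 (hmin y hyB.1.1)
  obtain ⟨d, hd, hdS⟩ := exists_pos_le_norm_sub hS hyB.1.1
  have hoff : ∀ θ, circleMap y (d / 2) θ ∉ S := by
    intro θ hθ
    have h1 := hdS _ hθ
    have h2 : ‖circleMap y (d / 2) θ - y‖ = d / 2 := by
      simp [circleMap, abs_of_pos hd]
    rw [norm_sub_rev] at h1
    linarith
  have havg := circleAverage_logMean hS hν (half_pos hd) (half_lt_self hd) hdS
  have hp : logMean ν y < logMean ν (circleMap y (d / 2) 0) := by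
    rw [hyx]
    refine lt_of_le_of_ne (hmin _ (hoff 0)) fun heq => ?_
    have hpB : circleMap y (d / 2) 0 ∈ B :=
      ⟨⟨hoff 0, by rw [← heq]; exact hxA.2⟩, heq.ge⟩
    have := hymax hpB
    simp [circleMap] at this
    linarith
  have hint : (∫ _θ in (0 : ℝ)..2 * Real.pi, logMean ν y) <
      ∫ θ in (0 : ℝ)..2 * Real.pi, logMean ν (circleMap y (d / 2) θ) := by
    refine intervalIntegral.integral_lt_integral_of_continuousOn_of_le_of_exists_lt
      Real.two_pi_pos continuousOn_const ?_ (fun θ _ => ?_) ⟨0, ⟨le_rfl, Real.two_pi_pos.le⟩, hp⟩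
    · exact hcont.comp (continuous_circleMap _ _).continuousOn fun θ _ => hoff θ
    · rw [hyx]; exact hmin _ (hoff θ)
  rw [Real.circleAverage_def, smul_eq_mul, inv_mul_eq_iff_eq_mul₀ (by positivity)] at havg
  rw [intervalIntegral.integral_const, havg, sub_zero, smul_eq_mul] at hint
  exact lt_irrefl _ hint

/-! ### The variational inequality and Frostman's theorem -/

/-- The potential at `z` is the integral of the kernel against `δ_z × ν`, and this measure depends
weakly continuously on `z`. -/
theorem lowerSemicontinuous_posPot (R : ℝ) (ν : Measure ℂ) [hν : IsProbabilityMeasure ν] :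
    LowerSemicontinuous (posPot R ν) := by
  obtain ⟨P, hP⟩ : ∃ P : ProbabilityMeasure ℂ, (P : Measure ℂ) = ν := ⟨⟨ν, hν⟩, rfl⟩
  have h := (lowerSemicontinuous_lintegral_probabilityMeasure (continuous_posKernel R)).comp
    (ProbabilityMeasure.continuous_prod.comp
      ((continuous_diracProba (X := ℂ)).prodMk (continuous_const (y := P))))
  convert h using 1
  ext z
  have hd : ((diracProba z : ProbabilityMeasure ℂ) : Measure ℂ) = Measure.dirac z := rfl
  simp only [Function.comp_apply, ProbabilityMeasure.toMeasure_prod]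
  rw [lintegral_prod _ (measurable_posKernel R).aemeasurable, hd, hP]
  exact (lintegral_dirac' z (measurable_posPot R ν)).symm

theorem posPot_add (R : ℝ) (μ ν : Measure ℂ) (z : ℂ) :
    posPot R (μ + ν) z = posPot R μ z + posPot R ν z := lintegral_add_measure _ _ _

theorem posPot_smul (R : ℝ) (c : ℝ≥0∞) (ν : Measure ℂ) (z : ℂ) :
    posPot R (c • ν) z = c * posPot R ν z := by
  simp [posPot, lintegral_smul_measure]

theorem posEnergy_add_left (R : ℝ) (μ₁ μ₂ ν : Measure ℂ) :
    posEnergy R (μ₁ + μ₂) ν = posEnergy R μ₁ ν + posEnergy R μ₂ ν := lintegral_add_measure _ _ _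

theorem posEnergy_smul_left (R : ℝ) (c : ℝ≥0∞) (μ ν : Measure ℂ) :
    posEnergy R (c • μ) ν = c * posEnergy R μ ν := by
  simp [posEnergy, lintegral_smul_measure]

theorem posEnergy_add_right (R : ℝ) (μ ν₁ ν₂ : Measure ℂ) [SFinite ν₁] :
    posEnergy R μ (ν₁ + ν₂) = posEnergy R μ ν₁ + posEnergy R μ ν₂ := by
  simp only [posEnergy, posPot_add]
  exact lintegral_add_left (measurable_posPot R ν₁) _

theorem posEnergy_smul_right (R : ℝ) (c : ℝ≥0∞) (μ ν : Measure ℂ) [SFinite ν] :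
    posEnergy R μ (c • ν) = c * posEnergy R μ ν := by
  simp only [posEnergy, posPot_smul]
  exact lintegral_const_mul _ (measurable_posPot R ν)

theorem IsEquilibriumMeasure.posEnergy_le {K : Set ℂ} {μ : Measure ℂ}
    (hμ : IsEquilibriumMeasure K μ) {R : ℝ} (hR : 1 ≤ R) (hK : ∀ z ∈ K, ∀ w ∈ K, ‖z - w‖ ≤ R)
    {ν : Measure ℂ} (hν : ν ∈ probMeasuresOn K) : posEnergy R μ μ ≤ posEnergy R ν ν := by
  have h := hμ.2 ν hν
  rw [logEnergy_eq hμ.1 hR hK, logEnergy_eq hν hR hK, sub_eq_add_neg, sub_eq_add_neg,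
    ← EReal.coe_neg] at h
  exact EReal.coe_ennreal_le_coe_ennreal_iff.1
    ((EReal.addLECancellable_coe _).add_le_add_iff_right.1 h)

/-- The quadratic takes the value `a` at `t = 0` and has derivative `2 (b - a)` there, which cannot
be negative. -/
theorem le_of_forall_quadratic_le {a b d : ℝ}
    (h : ∀ t : ℝ, 0 < t → t < 1 → a ≤ (1 - t) ^ 2 * a + 2 * (t * (1 - t)) * b + t ^ 2 * d) :
    a ≤ b := by
  by_contra! hlt
  -- Chosen so small that the second-order term `t (a - 2b + d)` is at most `a - b`, against the
  -- lower bound `2 (a - b)`.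
  set t := min (1 / 2) ((a - b) / (1 + |a - 2 * b + d|)) with ht
  have hc : 0 < 1 + |a - 2 * b + d| := by positivity
  have ht0 : 0 < t := lt_min (by norm_num) (div_pos (by linarith) hc)
  have ht1 : t ≤ 1 / 2 := min_le_left _ _
  have ht2 : t * (1 + |a - 2 * b + d|) ≤ a - b := by
    rw [← le_div_iff₀ hc]; exact min_le_right _ _
  have h1 := h t ht0 (by linarith)
  have h2 : 2 * t * (a - b) ≤ t * (t * (a - 2 * b + d)) := by nlinarith
  have h3 : 2 * (a - b) ≤ t * (a - 2 * b + d) := by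
    have : t * (2 * (a - b)) ≤ t * (t * (a - 2 * b + d)) := by linarith
    exact le_of_mul_le_mul_left this ht0
  have h4 : t * (a - 2 * b + d) ≤ t * (1 + |a - 2 * b + d|) := by
    have := le_abs_self (a - 2 * b + d)
    exact mul_le_mul_of_nonneg_left (by linarith) ht0.le
  linarith

/-- The variational inequality for the equilibrium measure. -/
theorem IsEquilibriumMeasure.posEnergy_le_mutual {K : Set ℂ} {μ : Measure ℂ}
    (hμ : IsEquilibriumMeasure K μ) {R : ℝ} (hR : 1 ≤ R) (hK : ∀ z ∈ K, ∀ w ∈ K, ‖z - w‖ ≤ R)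
    {ν : Measure ℂ} (hν : ν ∈ probMeasuresOn K) (hfin : posEnergy R ν ν ≠ ∞) :
    posEnergy R μ μ ≤ posEnergy R ν μ := by
  have := hμ.1.1
  have := hν.1
  have hμfin : posEnergy R μ μ ≠ ∞ := ne_top_of_le_ne_top hfin (hμ.posEnergy_le hR hK hν)
  by_cases hcross : posEnergy R ν μ = ∞
  · simp [hcross]
  rw [← ENNReal.toReal_le_toReal hμfin hcross]
  refine le_of_forall_quadratic_le (d := (posEnergy R ν ν).toReal) fun t ht0 ht1 => ?_
  have ht : 0 < 1 - t := by linarith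
  -- The competitor `(1 - t) μ + t ν`, whose energy is a quadratic polynomial in `t`.
  set ρ : Measure ℂ := ENNReal.ofReal (1 - t) • μ + ENNReal.ofReal t • ν with hρ
  have hρmem : ρ ∈ probMeasuresOn K := by
    constructor
    · constructor
      simp only [hρ, Measure.add_apply, Measure.smul_apply, measure_univ, smul_eq_mul, mul_one]
      rw [← ENNReal.ofReal_add ht.le ht0.le]
      simp
    · simp [hρ, hμ.1.2, hν.2]
  have hle := hμ.posEnergy_le hR hK hρmem
  have hexp : posEnergy R ρ ρ = ENNReal.ofReal (1 - t) *
      (ENNReal.ofReal (1 - t) * posEnergy R μ μ + ENNReal.ofReal t * posEnergy R ν μ) +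
      ENNReal.ofReal t *
      (ENNReal.ofReal (1 - t) * posEnergy R ν μ + ENNReal.ofReal t * posEnergy R ν ν) := by
    rw [hρ, posEnergy_add_left, posEnergy_smul_left, posEnergy_smul_left, posEnergy_add_right,
      posEnergy_add_right, posEnergy_smul_right, posEnergy_smul_right, posEnergy_smul_right,
      posEnergy_smul_right, posEnergy_comm R μ ν]
  rw [hexp] at hle
  lift posEnergy R μ μ to NNReal using hμfin with a
  lift posEnergy R ν μ to NNReal using hcross with b
  lift posEnergy R ν ν to NNReal using hfin with d
  have h2 := ENNReal.toReal_mono (by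
    simp [ENNReal.add_eq_top, ENNReal.mul_eq_top]) hle
  rw [ENNReal.toReal_add (by simp [ENNReal.mul_eq_top]) (by simp [ENNReal.mul_eq_top]),
    ENNReal.toReal_mul, ENNReal.toReal_mul,
    ENNReal.toReal_add (by simp [ENNReal.mul_eq_top]) (by simp [ENNReal.mul_eq_top]),
    ENNReal.toReal_add (by simp [ENNReal.mul_eq_top]) (by simp [ENNReal.mul_eq_top]),
    ENNReal.toReal_mul, ENNReal.toReal_mul, ENNReal.toReal_mul, ENNReal.toReal_mul,
    ENNReal.toReal_ofReal ht.le, ENNReal.toReal_ofReal ht0.le] at h2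
  linarith

/-- The variational inequality for the normalized restriction of `μ` to `B`: the average of the
potential over any set of positive mass is at least the energy. -/
theorem IsEquilibriumMeasure.le_setLIntegral {K : Set ℂ} {μ : Measure ℂ}
    (hμ : IsEquilibriumMeasure K μ) {R : ℝ} (hR : 1 ≤ R) (hK : ∀ z ∈ K, ∀ w ∈ K, ‖z - w‖ ≤ R)
    (hfin : posEnergy R μ μ ≠ ∞) (B : Set ℂ) :
    posEnergy R μ μ * μ B ≤ ∫⁻ z in B, posPot R μ z ∂μ := by
  have := hμ.1.1
  by_cases h0 : μ B = 0
  · simp [h0]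
  have hB : μ B ≠ ∞ := measure_ne_top _ _
  set ν : Measure ℂ := (μ B)⁻¹ • μ.restrict B with hν
  have hmem : ν ∈ probMeasuresOn K := by
    constructor
    · constructor
      simp [hν, ENNReal.inv_mul_cancel h0 hB]
    · have : μ.restrict B Kᶜ = 0 := Measure.absolutelyContinuous_of_le Measure.restrict_le_self hμ.1.2
      simp [hν, this]
  have hle : posEnergy R (μ.restrict B) (μ.restrict B) ≤ posEnergy R μ μ :=
    lintegral_mono' Measure.restrict_le_self
      fun z => lintegral_mono' Measure.restrict_le_self le_rfl
  have hνfin : posEnergy R ν ν ≠ ∞ := by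
    rw [hν, posEnergy_smul_left, posEnergy_smul_right]
    have : (μ B)⁻¹ ≠ ∞ := ENNReal.inv_ne_top.2 h0
    exact ENNReal.mul_ne_top this (ENNReal.mul_ne_top this (ne_top_of_le_ne_top hfin hle))
  have h := hμ.posEnergy_le_mutual hR hK hmem hνfin
  rw [hν, posEnergy_smul_left, ← ENNReal.div_eq_inv_mul,
    ENNReal.le_div_iff_mul_le (Or.inl h0) (Or.inl hB)] at h
  exact h

/-- If the potential exceeded the energy at a point of the support, by lower semicontinuity it would
do so on an open set of positive mass. Its average over the complement cannot compensate, by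
`le_setLIntegral`. -/
theorem IsEquilibriumMeasure.posPot_le_of_mem_support {K : Set ℂ} {μ : Measure ℂ}
    (hμ : IsEquilibriumMeasure K μ) {R : ℝ} (hR : 1 ≤ R) (hK : ∀ z ∈ K, ∀ w ∈ K, ‖z - w‖ ≤ R)
    (hfin : posEnergy R μ μ ≠ ∞) {z : ℂ} (hz : z ∈ μ.support) :
    posPot R μ z ≤ posEnergy R μ μ := by
  have := hμ.1.1
  by_contra! hlt
  obtain ⟨c, hc1, hc2⟩ := exists_between hlt
  set V : Set ℂ := {x | c < posPot R μ x}
  have hVo : IsOpen V := (lowerSemicontinuous_posPot R μ).isOpen_preimage c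
  have hV : 0 < μ V := (Measure.mem_support_iff_forall z).1 hz V (hVo.mem_nhds hc2)
  have h1 : c * μ V ≤ ∫⁻ x in V, posPot R μ x ∂μ := by
    rw [← setLIntegral_const]
    exact setLIntegral_mono (measurable_posPot R μ) fun x hx => le_of_lt hx
  have h2 := hμ.le_setLIntegral hR hK hfin Vᶜ
  have h3 : (∫⁻ x in V, posPot R μ x ∂μ) + ∫⁻ x in Vᶜ, posPot R μ x ∂μ = posEnergy R μ μ :=
    lintegral_add_compl _ hVo.measurableSet
  have h4 : posEnergy R μ μ * μ V + posEnergy R μ μ * μ Vᶜ = posEnergy R μ μ := by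
    rw [← mul_add, measure_add_measure_compl hVo.measurableSet, measure_univ, mul_one]
  have h5 : c * μ V + posEnergy R μ μ * μ Vᶜ ≤
      posEnergy R μ μ * μ V + posEnergy R μ μ * μ Vᶜ := by
    rw [h4]; exact (add_le_add h1 h2).trans h3.le
  have h6 : c * μ V ≤ posEnergy R μ μ * μ V :=
    (ENNReal.add_le_add_iff_right (ENNReal.mul_ne_top hfin (measure_ne_top _ _))).1 h5
  exact absurd ((ENNReal.mul_le_mul_iff_left hV.ne' (measure_ne_top _ _)).1 h6) (not_le.2 hc1)

/-- Frostman's theorem, upper bound: the potential of the equilibrium measure is at most its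
energy. -/
theorem IsEquilibriumMeasure.posPot_le {K : Set ℂ} (hKc : IsCompact K) {μ : Measure ℂ}
    (hμ : IsEquilibriumMeasure K μ) {R : ℝ} (hR : 1 ≤ R) (hK : ∀ z ∈ K, ∀ w ∈ K, ‖z - w‖ ≤ R)
    (hfin : posEnergy R μ μ ≠ ∞) {z : ℂ} (hz : z ∈ K) :
    posPot R μ z ≤ posEnergy R μ μ := by
  have := hμ.1.1
  have hae := ae_mem_of_mem_probMeasuresOn hμ.1
  have hR0 : 0 < R := by linarith
  have hSK : μ.support ⊆ K := by
    intro x hx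
    by_contra hxK
    exact ((Measure.mem_support_iff_forall x).1 hx Kᶜ
      (hKc.isClosed.isOpen_compl.mem_nhds hxK)).ne' hμ.1.2
  have hS : IsCompact μ.support := hKc.of_isClosed_subset Measure.isClosed_support hSK
  have hle : ∀ x ∈ K, ∀ᵐ w ∂μ, ‖x - w‖ ≤ R := fun x hx => hae.mono fun w hw => hK x hx w hw
  by_cases hzS : z ∈ μ.support
  · exact hμ.posPot_le_of_mem_support hR hK hfin hzS
  -- The maximum principle carries the bound from the support of `μ` to the rest of `K`.
  have hmean := le_logMean_of_forall_mem hS Measure.support_mem_ae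
    (m := Real.log R - (posEnergy R μ μ).toReal) (fun x hx => by
      have hp := hμ.posPot_le_of_mem_support hR hK hfin hx
      have hpt := ne_top_of_le_ne_top hfin hp
      refine ⟨integrable_log_norm_of_posPot_ne_top hR (hle x (hSK hx)) hpt,
        measure_singleton_eq_zero_of_posPot_ne_top hR0 hpt, ?_⟩
      rw [posPot_eq_ofReal hR (hle x (hSK hx)) hpt, ENNReal.ofReal_le_iff_le_toReal hfin] at hp
      unfold logMean
      linarith) z
  obtain ⟨d, hd, hdS⟩ := exists_pos_le_norm_sub hS hzS
  have hpt : posPot R μ z ≠ ∞ := posPot_ne_top_of_le_norm hR0 hd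
    (Filter.Eventually.mono Measure.support_mem_ae hdS)
  rw [posPot_eq_ofReal hR (hle z hz) hpt, ENNReal.ofReal_le_iff_le_toReal hfin]
  unfold logMean at hmean
  linarith

/-- Frostman's theorem in integrated form. -/
theorem IsEquilibriumMeasure.posEnergy_eq {K : Set ℂ} (hKc : IsCompact K) {μ : Measure ℂ}
    (hμ : IsEquilibriumMeasure K μ) {R : ℝ} (hR : 1 ≤ R) (hK : ∀ z ∈ K, ∀ w ∈ K, ‖z - w‖ ≤ R)
    {ν : Measure ℂ} (hν : ν ∈ probMeasuresOn K) (hfin : posEnergy R ν ν ≠ ∞) :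
    posEnergy R ν μ = posEnergy R μ μ := by
  have := hν.1
  have hμfin : posEnergy R μ μ ≠ ∞ := ne_top_of_le_ne_top hfin (hμ.posEnergy_le hR hK hν)
  refine le_antisymm ?_ (hμ.posEnergy_le_mutual hR hK hν hfin)
  calc posEnergy R ν μ ≤ ∫⁻ _z, posEnergy R μ μ ∂ν :=
        lintegral_mono_ae ((ae_mem_of_mem_probMeasuresOn hν).mono fun z hz =>
          hμ.posPot_le hKc hR hK hμfin hz)
    _ = _ := by simp

/-- On `K` the potential is at most the energy, and its `ν`-integral equals the energy. -/
theorem IsEquilibriumMeasure.posPot_ae_eq {K : Set ℂ} (hKc : IsCompact K) {μ : Measure ℂ}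
    (hμ : IsEquilibriumMeasure K μ) {R : ℝ} (hR : 1 ≤ R) (hK : ∀ z ∈ K, ∀ w ∈ K, ‖z - w‖ ≤ R)
    {ν : Measure ℂ} (hν : ν ∈ probMeasuresOn K) (hfin : posEnergy R ν ν ≠ ∞) :
    ∀ᵐ z ∂ν, posPot R μ z = posEnergy R μ μ := by
  have := hν.1
  have := hμ.1.1
  have hμfin : posEnergy R μ μ ≠ ∞ := ne_top_of_le_ne_top hfin (hμ.posEnergy_le hR hK hν)
  have heq := hμ.posEnergy_eq hKc hR hK hν hfin
  have hle : posPot R μ ≤ᵐ[ν] fun _ => posEnergy R μ μ :=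
    (ae_mem_of_mem_probMeasuresOn hν).mono fun z hz => hμ.posPot_le hKc hR hK hμfin hz
  refine ae_eq_of_ae_le_of_lintegral_le hle ?_ aemeasurable_const ?_
  · change posEnergy R ν μ ≠ ∞
    rw [heq]; exact hμfin
  · rw [lintegral_const, measure_univ, mul_one]; exact heq.ge

/-! ### Measurable sections and lifting of measures of finite energy -/

/-- The minimum of `φ` over the fibre `N ∩ f ⁻¹' {u}`. -/
def fiberMin (N : Set ℂ) (f : ℂ → ℂ) (φ : ℂ → ℝ) (u : ℂ) : ℝ := sInf (φ '' (N ∩ f ⁻¹' {u}))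

theorem exists_fiberMin {N : Set ℂ} (hN : IsCompact N) {f : ℂ → ℂ} (hf : ContinuousOn f N)
    {φ : ℂ → ℝ} (hφ : Continuous φ) {u : ℂ} (hu : u ∈ f '' N) :
    ∃ z ∈ N, f z = u ∧ φ z = fiberMin N f φ u ∧ ∀ w ∈ N, f w = u → φ z ≤ φ w := by
  have hc : IsCompact (N ∩ f ⁻¹' {u}) :=
    hN.of_isClosed_subset (hf.preimage_isClosed_of_isClosed hN.isClosed isClosed_singleton)
      inter_subset_left
  obtain ⟨z0, hz0, rfl⟩ := hu
  obtain ⟨z, hz, hmin, hle⟩ := hc.exists_sInf_image_eq_and_le ⟨z0, hz0, rfl⟩ hφ.continuousOn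
  exact ⟨z, hz.1, hz.2, hmin.symm, fun w hw hfw => hle w ⟨hw, hfw⟩⟩

theorem measurable_fiberMin {N : Set ℂ} (hN : IsCompact N) {f : ℂ → ℂ} (hf : ContinuousOn f N)
    {φ : ℂ → ℝ} (hφ : Continuous φ) : Measurable (fiberMin N f φ) := by
  refine measurable_of_Iic fun c => ?_
  have hNc : IsCompact (N ∩ φ ⁻¹' Iic c) := hN.inter_right (isClosed_Iic.preimage hφ)
  have h1 : MeasurableSet (f '' (N ∩ φ ⁻¹' Iic c)) :=
    (hNc.image_of_continuousOn (hf.mono inter_subset_left)).measurableSet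
  have h2 : MeasurableSet (f '' N) := (hN.image_of_continuousOn hf).measurableSet
  -- A sublevel set is the image of a compact set, up to the points with empty fibre, where `sInf ∅
  -- = 0`.
  have heq : fiberMin N f φ ⁻¹' Iic c =
      f '' (N ∩ φ ⁻¹' Iic c) ∪ ((f '' N)ᶜ ∩ {_u | 0 ≤ c}) := by
    ext u
    by_cases hu : u ∈ f '' N
    · obtain ⟨z, hz, hzu, hzmin, hle⟩ := exists_fiberMin hN hf hφ hu
      simp only [mem_preimage, mem_Iic, mem_union, mem_inter_iff, mem_compl_iff, hu,
        not_true_eq_false, false_and, or_false]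
      constructor
      · intro h
        exact ⟨z, ⟨hz, by rw [mem_preimage, mem_Iic, hzmin]; exact h⟩, hzu⟩
      · rintro ⟨w, ⟨hw, hwc⟩, hwu⟩
        rw [← hzmin]; exact (hle w hw hwu).trans hwc
    · have hempty : N ∩ f ⁻¹' {u} = ∅ := by
        ext w; simp only [mem_inter_iff, mem_preimage, mem_singleton_iff, mem_empty_iff_false,
          iff_false, not_and]
        exact fun hw hwu => hu ⟨w, hw, hwu⟩
      have hnot : u ∉ f '' (N ∩ φ ⁻¹' Iic c) := fun h => hu (image_mono inter_subset_left h)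
      have h0 : fiberMin N f φ u = 0 := by simp [fiberMin, hempty]
      simp only [mem_preimage, mem_Iic, h0, mem_union, hnot, mem_inter_iff, mem_compl_iff, hu,
        not_false_eq_true, true_and, false_or, mem_ofPred_eq]
  rw [heq]
  exact h1.union (h2.compl.inter (MeasurableSet.const _))

/-- A continuous map on a compact subset of the plane has a Borel section, obtained by choosing
the lexicographically least point of each fibre. -/
theorem exists_measurable_section {N : Set ℂ} (hN : IsCompact N) {f : ℂ → ℂ}
    (hf : ContinuousOn f N) : ∃ s : ℂ → ℂ, Measurable s ∧ ∀ u ∈ f '' N, s u ∈ N ∧ f (s u) = u := by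
  classical
  set m := fiberMin N f Complex.re with hm
  have hmm : Measurable m := measurable_fiberMin hN hf Complex.continuous_re
  let T : ℂ → Set ℂ := fun u => N ∩ f ⁻¹' {u} ∩ {z | z.re = m u}
  let k : ℂ → ℝ := fun u => sInf (Complex.im '' T u)
  have hex : ∀ u ∈ f '' N, ∃ z ∈ T u, z.im = k u ∧ ∀ w ∈ T u, z.im ≤ w.im := by
    intro u hu
    have hc : IsCompact (T u) := by
      have hc : IsCompact (N ∩ f ⁻¹' {u}) :=
        hN.of_isClosed_subset (hf.preimage_isClosed_of_isClosed hN.isClosed isClosed_singleton)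
          inter_subset_left
      exact hc.inter_right (isClosed_singleton.preimage Complex.continuous_re)
    obtain ⟨z, hz, hzu, hzmin, -⟩ := exists_fiberMin hN hf Complex.continuous_re hu
    obtain ⟨w, hw, hmin, hle⟩ := hc.exists_sInf_image_eq_and_le ⟨z, ⟨hz, hzu⟩, hzmin⟩
      Complex.continuous_im.continuousOn
    exact ⟨w, hw, hmin.symm, hle⟩
  have hk : Measurable k := by
    refine measurable_of_Iic fun c => ?_
    set Nc := N ∩ Complex.im ⁻¹' Iic c
    have hNc : IsCompact Nc := hN.inter_right (isClosed_Iic.preimage Complex.continuous_im)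
    have hfc : ContinuousOn f Nc := hf.mono inter_subset_left
    have h1 : MeasurableSet (f '' Nc) := (hNc.image_of_continuousOn hfc).measurableSet
    have h2 : MeasurableSet (f '' N) := (hN.image_of_continuousOn hf).measurableSet
    have h3 : MeasurableSet {u | fiberMin Nc f Complex.re u = m u} :=
      measurableSet_eq_fun (measurable_fiberMin hNc hfc Complex.continuous_re) hmm
    -- The least point of the fibre has imaginary part at most `c` exactly when cutting `N` down to
    -- `im ≤ c` leaves the minimal real part of the fibre unchanged.
    have heq : k ⁻¹' Iic c = (f '' Nc ∩ {u | fiberMin Nc f Complex.re u = m u}) ∪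
        ((f '' N)ᶜ ∩ {_u | 0 ≤ c}) := by
      ext u
      by_cases hu : u ∈ f '' N
      · obtain ⟨z, hz, hzk, hle⟩ := hex u hu
        simp only [mem_preimage, mem_Iic, mem_union, mem_inter_iff, mem_compl_iff, hu,
          not_true_eq_false, false_and, or_false, mem_ofPred_eq]
        constructor
        · intro h
          have hzc : z ∈ Nc := ⟨hz.1.1, by rw [mem_preimage, mem_Iic, hzk]; exact h⟩
          have huc : u ∈ f '' Nc := ⟨z, hzc, hz.1.2⟩
          refine ⟨huc, ?_⟩
          obtain ⟨w, hw, hwu, hwm, hwle⟩ := exists_fiberMin hNc hfc Complex.continuous_re huc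
          obtain ⟨x, hx, hxu, hxm, hxle⟩ := exists_fiberMin hN hf Complex.continuous_re hu
          apply le_antisymm
          · rw [← hwm]; exact (hwle z hzc hz.1.2).trans hz.2.le
          · rw [← hwm, hm, ← hxm]; exact hxle w hw.1 hwu
        · rintro ⟨huc, hum⟩
          obtain ⟨w, hw, hwu, hwm, -⟩ := exists_fiberMin hNc hfc Complex.continuous_re huc
          rw [← hzk]
          exact (hle w ⟨⟨hw.1, hwu⟩, hwm.trans hum⟩).trans hw.2
      · have hempty : T u = ∅ := by
          ext w
          simp only [mem_empty_iff_false, iff_false]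
          exact fun hw => hu ⟨w, hw.1.1, hw.1.2⟩
        have hnot : u ∉ f '' Nc := fun h => hu (image_mono inter_subset_left h)
        have h0 : k u = 0 := by simp [k, hempty]
        simp only [mem_preimage, mem_Iic, h0, mem_union, hnot, mem_inter_iff, mem_compl_iff, hu,
          not_false_eq_true, true_and, false_or, mem_ofPred_eq, false_and]
    rw [heq]
    exact (h1.inter h3).union (h2.compl.inter (MeasurableSet.const _))
  refine ⟨fun u => (m u : ℂ) + (k u : ℂ) * Complex.I, by fun_prop, fun u hu => ?_⟩
  obtain ⟨z, hz, hzk, -⟩ := hex u hu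
  have hzs : (m u : ℂ) + (k u : ℂ) * Complex.I = z := by
    rw [← hzk, ← hz.2]; exact Complex.re_add_im z
  simp only [hzs]
  exact hz.1

theorem posKernel_le_of_norm_le {R L : ℝ} (hR : 0 < R) (hL : 0 < L) {a b u v : ℂ}
    (h : ‖u - v‖ ≤ L * ‖a - b‖) : posKernel R a b ≤ posKernel (L * R) u v := by
  by_cases huv : u = v
  · subst huv; simp [posKernel_self (mul_pos hL hR)]
  have h1 : 0 < ‖u - v‖ := norm_pos_iff.2 (sub_ne_zero.2 huv)
  have h2 : 0 < ‖a - b‖ := pos_of_mul_pos_right (h1.trans_le h) hL.le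
  rw [posKernel_eq_ofReal hR (fun hab => by simp [hab] at h2),
    posKernel_eq_ofReal (mul_pos hL hR) huv]
  apply ENNReal.ofReal_le_ofReal
  apply Real.log_le_log (by positivity)
  rw [div_le_div_iff₀ h2 h1]
  nlinarith

theorem posEnergy_map (R : ℝ) (μ ν : Measure ℂ) [SFinite ν] {s t : ℂ → ℂ} (hs : Measurable s)
    (ht : Measurable t) :
    posEnergy R (μ.map s) (ν.map t) = ∫⁻ u, ∫⁻ v, posKernel R (s u) (t v) ∂ν ∂μ := by
  unfold posEnergy
  rw [lintegral_map (measurable_posPot R _) hs]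
  unfold posPot
  simp_rw [lintegral_map (measurable_posKernel_right R _) ht]

/-- A map whose inverse is Lipschitz transports finite energy. -/
theorem posEnergy_map_ne_top {R L : ℝ} (hR : 0 < R) (hL : 0 < L) {ν : Measure ℂ}
    [IsFiniteMeasure ν] {s : ℂ → ℂ} (hs : Measurable s) {A : Set ℂ} (hA : ∀ᵐ u ∂ν, u ∈ A)
    (h : ∀ u ∈ A, ∀ v ∈ A, ‖u - v‖ ≤ L * ‖s u - s v‖) (hfin : posEnergy R ν ν ≠ ∞) :
    posEnergy R (ν.map s) (ν.map s) ≠ ∞ := by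
  refine ne_top_of_le_ne_top (posEnergy_ne_top_of_ne_top hR (mul_pos hL hR) hfin) ?_
  rw [posEnergy_map R ν ν hs hs]
  refine lintegral_mono_ae (hA.mono fun u hu => ?_)
  exact lintegral_mono_ae (hA.mono fun v hv => posKernel_le_of_norm_le hR hL (h u hu v hv))

/-- Restrict `ν` to `f(N)`, push it forward by a Borel section of `f` and normalize. As `f` is
Lipschitz, the section shrinks distances at most by the factor `L`, so the energy stays finite. -/
theorem exists_probMeasuresOn_posEnergy_ne_top {N : Set ℂ} (hN : IsCompact N) {f : ℂ → ℂ}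
    {L : ℝ} (hL : 0 < L) (hf : ∀ z ∈ N, ∀ w ∈ N, ‖f z - f w‖ ≤ L * ‖z - w‖) {R : ℝ}
    (hR : 0 < R) {ν : Measure ℂ} [IsFiniteMeasure ν] (hfin : posEnergy R ν ν ≠ ∞)
    (hpos : ν (f '' N) ≠ 0) : ∃ μ ∈ probMeasuresOn N, posEnergy R μ μ ≠ ∞ := by
  have hfc : ContinuousOn f N :=
    (LipschitzOnWith.of_dist_le_mul (K := L.toNNReal) fun z hz w hw => by
      rw [dist_eq_norm, dist_eq_norm, Real.coe_toNNReal _ hL.le]; exact hf z hz w hw).continuousOn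
  obtain ⟨s, hs, hsec⟩ := exists_measurable_section hN hfc
  have hA : MeasurableSet (f '' N) := (hN.image_of_continuousOn hfc).measurableSet
  have hAt : ν (f '' N) ≠ ∞ := measure_ne_top _ _
  have hae : ∀ᵐ u ∂(ν.restrict (f '' N)), u ∈ f '' N := ae_restrict_mem hA
  refine ⟨(ν (f '' N))⁻¹ • (ν.restrict (f '' N)).map s, ⟨⟨?_⟩, ?_⟩, ?_⟩
  · rw [Measure.smul_apply, Measure.map_apply hs MeasurableSet.univ, preimage_univ,
      Measure.restrict_apply_univ, smul_eq_mul, ENNReal.inv_mul_cancel hpos hAt]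
  · rw [Measure.smul_apply, Measure.map_apply hs hN.measurableSet.compl]
    have : (ν.restrict (f '' N)) (s ⁻¹' Nᶜ) = 0 := by
      refine measure_mono_null (fun u hu => ?_) (ae_iff.1 hae)
      exact fun huA => hu (hsec u huA).1
    rw [this, smul_zero]
  · have hle : posEnergy R (ν.restrict (f '' N)) (ν.restrict (f '' N)) ≠ ∞ :=
      ne_top_of_le_ne_top hfin (lintegral_mono' Measure.restrict_le_self
        fun z => lintegral_mono' Measure.restrict_le_self le_rfl)
    have := posEnergy_map_ne_top hR hL hs hae (fun u hu v hv => by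
      have h1 := hf _ (hsec u hu).1 _ (hsec v hv).1
      rwa [(hsec u hu).2, (hsec v hv).2] at h1) hle
    have hinv : (ν (f '' N))⁻¹ ≠ ∞ := ENNReal.inv_ne_top.2 hpos
    rw [posEnergy_smul_left, posEnergy_smul_right]
    exact ENNReal.mul_ne_top hinv (ENNReal.mul_ne_top hinv this)

/-- A compact set on which the potential of the equilibrium measure is smaller than the energy
has images of measure zero under Lipschitz maps, for every measure of finite energy. -/
theorem IsEquilibriumMeasure.measure_image_eq_zero {K : Set ℂ} (hKc : IsCompact K)
    {μ : Measure ℂ} (hμ : IsEquilibriumMeasure K μ) {R : ℝ} (hR : 1 ≤ R)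
    (hK : ∀ z ∈ K, ∀ w ∈ K, ‖z - w‖ ≤ R) {f : ℂ → ℂ} {L : ℝ} (hL : 0 < L)
    (hf : ∀ z ∈ K, ∀ w ∈ K, ‖f z - f w‖ ≤ L * ‖z - w‖) {ν : Measure ℂ} [IsFiniteMeasure ν]
    (hfin : posEnergy R ν ν ≠ ∞) :
    ν (f '' {z ∈ K | posPot R μ z < posEnergy R μ μ}) = 0 := by
  have := hμ.1.1
  set I := posEnergy R μ μ with hI
  rcases eq_or_ne I 0 with h0 | h0
  · simp [h0]
  -- Levels increasing strictly to the energy split the exceptional set into countably many sublevel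
  -- sets, compact by lower semicontinuity. If the image of one were charged by `ν`, lifting `ν` to
  -- it would violate the variational inequality.
  obtain ⟨c, -, hcI, hc⟩ := exists_seq_strictMono_tendsto' (pos_iff_ne_zero.2 h0)
  have hsub : f '' {z ∈ K | posPot R μ z < I} ⊆
      ⋃ n, f '' (K ∩ posPot R μ ⁻¹' Iic (c n)) := by
    rintro _ ⟨z, ⟨hz, hlt⟩, rfl⟩
    obtain ⟨n, hn⟩ := (hc.eventually_const_lt hlt).exists
    exact mem_iUnion.2 ⟨n, z, ⟨hz, hn.le⟩, rfl⟩
  refine measure_mono_null hsub (measure_iUnion_null fun n => ?_)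
  by_contra hpos
  have hN : IsCompact (K ∩ posPot R μ ⁻¹' Iic (c n)) :=
    hKc.inter_right ((lowerSemicontinuous_posPot R μ).isClosed_preimage _)
  obtain ⟨ρ, hρ, hρfin⟩ := exists_probMeasuresOn_posEnergy_ne_top hN hL
    (fun z hz w hw => hf z hz.1 w hw.1) (by linarith) hfin hpos
  have hρK : ρ ∈ probMeasuresOn K :=
    ⟨hρ.1, measure_mono_null (compl_subset_compl.2 inter_subset_left) hρ.2⟩
  have := hρ.1
  have h1 := hμ.posEnergy_le_mutual hR hK hρK hρfin
  have h2 : posEnergy R ρ μ ≤ c n := by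
    calc posEnergy R ρ μ ≤ ∫⁻ _z, c n ∂ρ :=
          lintegral_mono_ae ((ae_mem_of_mem_probMeasuresOn hρ).mono fun z hz => hz.2)
      _ = c n := by simp
  exact absurd (h1.trans h2) (not_le.2 (hcI n).2)

/-! ### Preimages under `P / z ^ j` -/

open Polynomial in
theorem isBounded_ratPreimage {P : ℂ[X]} {j : ℕ} (hj : j < P.natDegree) {E : Set ℂ}
    (hE : Bornology.IsBounded E) : Bornology.IsBounded (ratPreimage P j E) := by
  obtain ⟨C, hC0, hC⟩ := hE.exists_pos_norm_le
  have hdeg : (X ^ j : ℂ[X]).degree < P.degree := degree_lt_degree (by rwa [natDegree_X_pow])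
  have ho := isLittleO_cobounded_of_degree_lt hdeg
  have hev := ho.bound (c := 1 / (2 * C)) (by positivity)
  rw [← Bornology.isCobounded_compl_iff, Bornology.isCobounded_def]
  filter_upwards [hev] with z hz
  rintro ⟨hz0, hzE⟩
  have h1 := hC _ hzE
  rw [eval_pow, eval_X] at hz
  have hpos : 0 < ‖z ^ j‖ := norm_pos_iff.2 (pow_ne_zero _ hz0)
  rw [norm_div, div_le_iff₀ hpos] at h1
  have h2 : ‖z ^ j‖ ≤ ‖z ^ j‖ / 2 := by
    calc ‖z ^ j‖ ≤ 1 / (2 * C) * ‖eval z P‖ := hz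
      _ ≤ 1 / (2 * C) * (C * ‖z ^ j‖) := by gcongr
      _ = _ := by field_simp
  linarith

open Polynomial in
-- The preimage lies in the closed set `|P(z)| ≤ C |z|^j`, which avoids the origin because `P(0) ≠
-- 0`; the rational function is therefore continuous on it.
theorem isCompact_ratPreimage {P : ℂ[X]} {j : ℕ} (hj0 : 0 < j) (hj : j < P.natDegree)
    (h0 : P.coeff 0 ≠ 0) {E : Set ℂ} (hE : IsCompact E) : IsCompact (ratPreimage P j E) := by
  obtain ⟨C, hC⟩ := hE.isBounded.exists_norm_le
  let T : Set ℂ := {z | ‖P.eval z‖ ≤ C * ‖z ^ j‖}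
  have hT : IsClosed T :=
    isClosed_le P.continuous.norm (continuous_const.mul (continuous_pow j).norm)
  have hT0 : ∀ z ∈ T, z ≠ 0 := by
    rintro z hz rfl
    have : ‖P.eval 0‖ ≤ C * ‖(0 : ℂ) ^ j‖ := hz
    rw [zero_pow hj0.ne', norm_zero, mul_zero, ← coeff_zero_eq_eval_zero] at this
    exact h0 (norm_le_zero_iff.1 this)
  have hcont : ContinuousOn (fun z => P.eval z / z ^ j) T :=
    P.continuous.continuousOn.div (continuous_pow j).continuousOn
      fun z hz => pow_ne_zero _ (hT0 z hz)
  have heq : ratPreimage P j E = T ∩ (fun z => P.eval z / z ^ j) ⁻¹' E := by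
    ext z
    constructor
    · rintro ⟨hz0, hz⟩
      have h1 := hC _ hz
      have hpos : 0 < ‖z ^ j‖ := norm_pos_iff.2 (pow_ne_zero _ hz0)
      rw [norm_div, div_le_iff₀ hpos] at h1
      exact ⟨h1, hz⟩
    · rintro ⟨hz, hzE⟩
      exact ⟨hT0 z hz, hzE⟩
  refine Metric.isCompact_of_isClosed_isBounded ?_ (isBounded_ratPreimage hj hE.isBounded)
  rw [heq]
  exact hcont.preimage_isClosed_of_isClosed hT hE.isClosed

open Polynomial in
-- Smoothness away from the pole gives local Lipschitz bounds, and compactness makes them global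
-- even though `K` need not be convex or connected.
theorem exists_lipschitz_ratFun (P : ℂ[X]) (j : ℕ) {K : Set ℂ} (hK : IsCompact K)
    (h0 : (0 : ℂ) ∉ K) : ∃ L : ℝ, 0 < L ∧ ∀ z ∈ K, ∀ w ∈ K,
      ‖P.eval z / z ^ j - P.eval w / w ^ j‖ ≤ L * ‖z - w‖ := by
  have hl : LocallyLipschitzOn K (fun z => P.eval z / z ^ j) := by
    intro z hz
    have hz0 : z ≠ 0 := fun h => h0 (h ▸ hz)
    have hd : ContDiffAt ℂ 1 (fun z => P.eval z / z ^ j) z :=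
      (Polynomial.contDiff_aeval P 1).contDiffAt.div (contDiff_id.pow j).contDiffAt (pow_ne_zero _ hz0)
    obtain ⟨L, t, ht, hL⟩ := hd.exists_lipschitzOnWith
    exact ⟨L, t, mem_nhdsWithin_of_mem_nhds ht, hL⟩
  obtain ⟨L, hL⟩ := hl.exists_lipschitzOnWith_of_compact hK
  refine ⟨L + 1, by positivity, fun z hz w hw => ?_⟩
  have := hL.dist_le_mul z hz w hw
  rw [dist_eq_norm, dist_eq_norm] at this
  refine this.trans ?_
  gcongr
  linarith

/-- The numerator `P - u z ^ j` of `P / z ^ j - u`. -/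
def levelPoly (P : Polynomial ℂ) (j : ℕ) (u : ℂ) : Polynomial ℂ :=
  P - Polynomial.C u * Polynomial.X ^ j

section
open Polynomial

variable {P : ℂ[X]} {j : ℕ}

theorem natDegree_levelPoly (hj : j < P.natDegree) (u : ℂ) :
    (levelPoly P j u).natDegree = P.natDegree := by
  unfold levelPoly
  exact natDegree_sub_eq_left_of_natDegree_lt ((natDegree_C_mul_X_pow_le u j).trans_lt hj)

theorem leadingCoeff_levelPoly (hj : j < P.natDegree) (u : ℂ) :
    (levelPoly P j u).leadingCoeff = P.leadingCoeff := by
  rw [leadingCoeff, natDegree_levelPoly hj]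
  simp [levelPoly, coeff_X_pow, hj.ne']

theorem eval_levelPoly (u z : ℂ) : (levelPoly P j u).eval z = P.eval z - u * z ^ j := by
  simp [levelPoly]

theorem levelPoly_ne_zero (hj : j < P.natDegree) (u : ℂ) : levelPoly P j u ≠ 0 := by
  intro h
  have := natDegree_levelPoly hj u
  rw [h, natDegree_zero] at this
  omega

theorem card_roots_levelPoly (hj : j < P.natDegree) (u : ℂ) :
    Multiset.card (levelPoly P j u).roots = P.natDegree := by
  rw [← natDegree_levelPoly hj u]
  exact (IsAlgClosed.splits _).natDegree_eq_card_roots.symm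

theorem mem_roots_levelPoly (hj0 : 0 < j) (hj : j < P.natDegree) (h0 : P.coeff 0 ≠ 0) {u z : ℂ} :
    z ∈ (levelPoly P j u).roots ↔ z ≠ 0 ∧ P.eval z / z ^ j = u := by
  rw [mem_roots (levelPoly_ne_zero hj u), IsRoot.def, eval_levelPoly, sub_eq_zero]
  constructor
  · intro h
    have hz : z ≠ 0 := by
      rintro rfl
      rw [zero_pow hj0.ne', mul_zero, ← coeff_zero_eq_eval_zero] at h
      exact h0 h
    exact ⟨hz, by rw [h, mul_div_cancel_right₀ _ (pow_ne_zero _ hz)]⟩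
  · rintro ⟨hz, rfl⟩
    rw [div_mul_cancel₀ _ (pow_ne_zero _ hz)]

theorem image_ratPreimage (hj0 : 0 < j) (hj : j < P.natDegree) (h0 : P.coeff 0 ≠ 0) (E : Set ℂ) :
    (fun z => P.eval z / z ^ j) '' ratPreimage P j E = E := by
  apply Subset.antisymm
  · rintro _ ⟨z, hz, rfl⟩
    exact hz.2
  · intro u hu
    have hcard := card_roots_levelPoly hj u
    obtain ⟨z, hz⟩ := Multiset.card_pos_iff_exists_mem.1 (by rw [hcard]; omega :
      0 < Multiset.card (levelPoly P j u).roots)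
    obtain ⟨hz0, hzu⟩ := (mem_roots_levelPoly hj0 hj h0).1 hz
    exact ⟨z, ⟨hz0, by rw [hzu]; exact hu⟩, hzu⟩

theorem log_norm_multiset_prod (s : Multiset ℂ) (hs : (0 : ℂ) ∉ s) :
    Real.log ‖s.prod‖ = (s.map fun z => Real.log ‖z‖).sum := by
  induction s using Multiset.induction with
  | empty => simp
  | cons a s ih =>
    rw [Multiset.mem_cons, not_or] at hs
    rw [Multiset.prod_cons, norm_mul, Real.log_mul (norm_ne_zero_iff.2 (Ne.symm hs.1))
      (norm_ne_zero_iff.2 (Multiset.prod_ne_zero hs.2)), ih hs.2, Multiset.map_cons,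
      Multiset.sum_cons]

/-- Factor `P(w) - u w^j` over its roots; the unimodular leading coefficient contributes nothing. -/
theorem log_norm_sub_ratFun (hj : j < P.natDegree) (hlead : ‖P.leadingCoeff‖ = 1) {u w : ℂ}
    (hw0 : w ≠ 0) (hw : w ∉ (levelPoly P j u).roots) :
    Real.log ‖u - P.eval w / w ^ j‖ =
      ((levelPoly P j u).roots.map fun z => Real.log ‖z - w‖).sum - j * Real.log ‖w‖ := by
  have h1 : u - P.eval w / w ^ j = -((levelPoly P j u).eval w / w ^ j) := by
    rw [eval_levelPoly]
    field_simp
    ring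
  have hz : (0 : ℂ) ∉ (levelPoly P j u).roots.map (fun z => w - z) := by
    intro h
    obtain ⟨z, hz, hzw⟩ := Multiset.mem_map.1 h
    rw [sub_eq_zero] at hzw
    exact hw (hzw ▸ hz)
  have h2 : ‖(levelPoly P j u).eval w‖ =
      ‖((levelPoly P j u).roots.map (fun z => w - z)).prod‖ := by
    rw [(IsAlgClosed.splits (levelPoly P j u)).eval_eq_prod_roots, norm_mul,
      leadingCoeff_levelPoly hj, hlead, one_mul]
  rw [h1, norm_neg, norm_div, h2, Real.log_div (norm_ne_zero_iff.2 (Multiset.prod_ne_zero hz))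
    (norm_ne_zero_iff.2 (pow_ne_zero _ hw0)), log_norm_multiset_prod _ hz, Multiset.map_map, norm_pow, Real.log_pow]
  congr 3
  ext z
  simp [norm_sub_rev]

end

/-! ### The energy identity for the preimage -/

theorem integral_multiset_sum {α ι : Type*} [MeasurableSpace α] {μ : Measure α} (s : Multiset ι)
    {f : ι → α → ℝ} (hf : ∀ i ∈ s, Integrable (f i) μ) :
    Integrable (fun x => (s.map fun i => f i x).sum) μ ∧
      ∫ x, (s.map fun i => f i x).sum ∂μ = (s.map fun i => ∫ x, f i x ∂μ).sum := by
  induction s using Multiset.induction with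
  | empty => simp
  | cons a s ih =>
    obtain ⟨h1, h2⟩ := ih fun i hi => hf i (Multiset.mem_cons_of_mem hi)
    have h3 := hf a (Multiset.mem_cons_self a s)
    simp only [Multiset.map_cons, Multiset.sum_cons]
    exact ⟨h3.add h1, by rw [integral_add h3 h1, h2]⟩

theorem logMean_zero (ν : Measure ℂ) : logMean ν 0 = ∫ w, Real.log ‖w‖ ∂ν := by
  simp [logMean]

theorem integrable_log_norm_of_notMem_zero {ν : Measure ℂ} [IsFiniteMeasure ν] {S : Set ℂ}
    (hS : IsCompact S) (hν : ∀ᵐ w ∂ν, w ∈ S) (h0 : (0 : ℂ) ∉ S) :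
    Integrable (fun w => Real.log ‖w‖) ν := by
  simpa using integrable_log_norm_of_notMem hS hν h0

theorem logMean_eq_of_posPot_eq {ν : Measure ℂ} [IsProbabilityMeasure ν] {R : ℝ} (hR : 1 ≤ R)
    {z : ℂ} (hle : ∀ᵐ w ∂ν, ‖z - w‖ ≤ R) {c : ℝ≥0∞} (hc : c ≠ ∞) (h : posPot R ν z = c) :
    logMean ν z = Real.log R - c.toReal := by
  have h1 := posPot_eq_ofReal hR hle (h.symm ▸ hc)
  rw [← h, h1, ENNReal.toReal_ofReal (sub_nonneg.2 (integral_log_norm_le hR hle))]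
  simp [logMean]

theorem le_logMean_of_posPot_le {ν : Measure ℂ} [IsProbabilityMeasure ν] {R : ℝ} (hR : 1 ≤ R)
    {z : ℂ} (hle : ∀ᵐ w ∂ν, ‖z - w‖ ≤ R) {c : ℝ≥0∞} (hc : c ≠ ∞) (h : posPot R ν z ≤ c) :
    Real.log R - c.toReal ≤ logMean ν z := by
  rw [logMean_eq_of_posPot_eq hR hle (ne_top_of_le_ne_top hc h) rfl]
  have := ENNReal.toReal_mono hc h
  linarith

open Polynomial in
/-- Energy and potential at the origin of the equilibrium measure of the preimage of a set of
capacity one under `P / z ^ j`. -/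
theorem natDegree_mul_energy_ratPreimage {P : ℂ[X]} {j : ℕ} (hj0 : 0 < j) (hj : j < P.natDegree)
    (hlead : ‖P.leadingCoeff‖ = 1) (h0 : P.coeff 0 ≠ 0) {E : Set ℂ} (hE : IsCompact E)
    {ν μ : Measure ℂ} (hν : IsEquilibriumMeasure E ν)
    (hμ : IsEquilibriumMeasure (ratPreimage P j E) μ) {R : ℝ} (hR : 1 < R)
    (hER : ∀ z ∈ E, ∀ w ∈ E, ‖z - w‖ ≤ R)
    (hKR : ∀ z ∈ ratPreimage P j E, ∀ w ∈ ratPreimage P j E, ‖z - w‖ ≤ R)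
    (hνR : posEnergy R ν ν = ENNReal.ofReal (Real.log R)) :
    posEnergy R μ μ ≠ ∞ ∧
      P.natDegree * (Real.log R - (posEnergy R μ μ).toReal) = j * logMean μ 0 := by
  set K := ratPreimage P j E with hKdef
  set r : ℂ → ℂ := fun z => P.eval z / z ^ j with hr
  have hK : IsCompact K := isCompact_ratPreimage hj0 hj h0 hE
  have hK0 : (0 : ℂ) ∉ K := fun h => h.1 rfl
  have hrm : Measurable r := P.continuous.measurable.div (measurable_id.pow_const j)
  have := hμ.1.1
  have := hν.1.1
  have hR0 : 0 < R := by linarith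
  have hR1 : 1 ≤ R := hR.le
  obtain ⟨L, hL, hLip⟩ := exists_lipschitz_ratFun P j hK hK0
  have himg : r '' K = E := image_ratPreimage hj0 hj h0 E
  have hνE : ν E ≠ 0 := by
    rw [(prob_compl_eq_zero_iff hE.measurableSet).1 hν.1.2]; exact one_ne_zero
  have hνfin : posEnergy R ν ν ≠ ∞ := hνR ▸ ENNReal.ofReal_ne_top
  -- `K` is non-polar because `ν` lifts to a measure of finite energy on it.
  have hfin : posEnergy R μ μ ≠ ∞ := by
    obtain ⟨ρ, hρ, hρfin⟩ := exists_probMeasuresOn_posEnergy_ne_top (f := r) hK hL hLip hR0 hνfin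
      (by rw [himg]; exact hνE)
    exact ne_top_of_le_ne_top hρfin (hμ.posEnergy_le hR1 hKR hρ)
  refine ⟨hfin, ?_⟩
  have hμK := ae_mem_of_mem_probMeasuresOn hμ.1
  have hle : ∀ x ∈ K, ∀ᵐ w ∂μ, ‖x - w‖ ≤ R := fun x hx => hμK.mono fun w hw => hKR x hx w hw
  have hpot : ∀ x ∈ K, posPot R μ x ≤ posEnergy R μ μ := fun x hx =>
    hμ.posPot_le hK hR1 hKR hfin hx
  have hpt : ∀ x ∈ K, posPot R μ x ≠ ∞ := fun x hx => ne_top_of_le_ne_top hfin (hpot x hx)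
  set e := (posEnergy R μ μ).toReal with he
  -- The value of `∫ log |u - r(w)| dμ(w)` when all `n` roots over `u` are Frostman points; the goal
  -- is `c = 0`.
  set c : ℝ := P.natDegree * (Real.log R - e) - j * logMean μ 0 with hc
  have hroot : ∀ u ∈ E, ∀ z ∈ (levelPoly P j u).roots, z ∈ K := by
    intro u hu z hz
    obtain ⟨hz0, hzu⟩ := (mem_roots_levelPoly hj0 hj h0).1 hz
    exact ⟨hz0, by rw [hzu]; exact hu⟩
  have hlam : ∀ u ∈ E, posPot R (μ.map r) u = ENNReal.ofReal (Real.log R -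
      (((levelPoly P j u).roots.map fun z => logMean μ z).sum - j * logMean μ 0)) := by
    intro u hu
    set s := (levelPoly P j u).roots with hs
    have hint := integral_multiset_sum (μ := μ) s (f := fun z w => Real.log ‖z - w‖)
      fun z hz => integrable_log_norm_of_posPot_ne_top hR1 (hle z (hroot u hu z hz))
        (hpt z (hroot u hu z hz))
    have hint0 := (integrable_log_norm_of_notMem_zero hK hμK hK0).const_mul (j : ℝ)
    have hnot : ∀ᵐ w ∂μ, w ∉ s := by
      have h1 : ∀ᵐ w ∂μ, ∀ z ∈ s.toFinset, z ≠ w := by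
        rw [Finset.eventually_all]
        intro z hz
        exact ae_ne_of_posPot_ne_top hR0 (hpt z (hroot u hu z (Multiset.mem_toFinset.1 hz)))
      filter_upwards [h1] with w hw hws
      exact hw w (Multiset.mem_toFinset.2 hws) rfl
    have hlog : ∀ᵐ w ∂μ, Real.log ‖u - r w‖ =
        (s.map fun z => Real.log ‖z - w‖).sum - j * Real.log ‖w‖ := by
      filter_upwards [hμK, hnot] with w hw hws
      exact log_norm_sub_ratFun hj hlead hw.1 hws
    have hbd : ∀ᵐ w ∂μ, (s.map fun z => Real.log ‖z - w‖).sum - j * Real.log ‖w‖ ≤ Real.log R := by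
      filter_upwards [hμK, hlog] with w hw hlw
      rw [← hlw]
      exact log_norm_le_log_of_norm_le hR1 (hER u hu _ hw.2)
    have hsub : Integrable (fun w => (s.map fun z => Real.log ‖z - w‖).sum - j * Real.log ‖w‖) μ :=
      hint.1.sub hint0
    have h2 := lintegral_ofReal_const_sub hsub hbd
    have h3 : ∫ w, ((s.map fun z => Real.log ‖z - w‖).sum - j * Real.log ‖w‖) ∂μ =
        (s.map fun z => logMean μ z).sum - j * logMean μ 0 := by
      rw [integral_sub hint.1 hint0, hint.2, integral_const_mul, logMean_zero]
      rfl
    rw [h3] at h2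
    rw [← h2, posPot, lintegral_map (measurable_posKernel_right R u) hrm]
    refine lintegral_congr_ae ?_
    filter_upwards [hμK, hnot, hlog] with w hw hws hlw
    have hne : u ≠ r w := by
      rintro rfl
      exact hws ((mem_roots_levelPoly hj0 hj h0).2 ⟨hw.1, rfl⟩)
    rw [posKernel_eq_ofReal_sub hR0 hne, hlw]
  have hcard : ∀ u, Multiset.card (levelPoly P j u).roots = P.natDegree :=
    card_roots_levelPoly hj
  have hmean_le : ∀ u ∈ E, P.natDegree * (Real.log R - e) ≤
      ((levelPoly P j u).roots.map fun z => logMean μ z).sum := by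
    intro u hu
    have := Multiset.card_nsmul_le_sum (s := (levelPoly P j u).roots.map fun z => logMean μ z)
      (a := Real.log R - e) (by
        intro x hx
        obtain ⟨z, hz, rfl⟩ := Multiset.mem_map.1 hx
        have hzK := hroot u hu z hz
        exact le_logMean_of_posPot_le hR1 (hle z hzK) hfin (hpot z hzK))
    rwa [Multiset.card_map, hcard, nsmul_eq_mul] at this
  have hlam_le : ∀ u ∈ E, posPot R (μ.map r) u ≤ ENNReal.ofReal (Real.log R - c) := by
    intro u hu
    rw [hlam u hu]
    apply ENNReal.ofReal_le_ofReal
    have := hmean_le u hu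
    simp only [hc]
    linarith
  have hlamE : μ.map r ∈ probMeasuresOn E := by
    refine ⟨Measure.isProbabilityMeasure_map hrm.aemeasurable, ?_⟩
    rw [Measure.map_apply hrm hE.measurableSet.compl]
    refine measure_mono_null (fun z hz => ?_) (ae_iff.1 hμK)
    exact fun hzK => hz hzK.2
  have hlamp := hlamE.1
  -- The potential of the push-forward is bounded on `E`, so it has finite energy and Frostman's
  -- theorem for `ν` applies to it.
  have hlamfin : posEnergy R (μ.map r) (μ.map r) ≠ ∞ := by
    refine ne_top_of_le_ne_top (b := ∫⁻ _u, ENNReal.ofReal (Real.log R - c) ∂(μ.map r)) ?_ ?_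
    · simp
    · exact lintegral_mono_ae ((ae_mem_of_mem_probMeasuresOn hlamE).mono hlam_le)
  have hmut : posEnergy R ν (μ.map r) = ENNReal.ofReal (Real.log R) := by
    rw [posEnergy_comm, hν.posEnergy_eq hE hR1 hER hlamE hlamfin, hνR]
  have hnull := hμ.measure_image_eq_zero hK hR1 hKR hL hLip hνfin
  -- For `ν`-almost every `u` no root over `u` is exceptional, so all the root inequalities are
  -- equalities.
  have hlam_eq : ∀ᵐ u ∂ν, posPot R (μ.map r) u = ENNReal.ofReal (Real.log R - c) := by
    have hnull' : ∀ᵐ u ∂ν, u ∉ r '' {z ∈ K | posPot R μ z < posEnergy R μ μ} :=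
      measure_eq_zero_iff_ae_notMem.1 hnull
    filter_upwards [hnull', ae_mem_of_mem_probMeasuresOn hν.1] with u hun hu
    rw [hlam u hu]
    have hall : (levelPoly P j u).roots.map (fun z => logMean μ z) =
        (levelPoly P j u).roots.map (fun _ => Real.log R - e) := by
      refine Multiset.map_congr rfl fun z hz => ?_
      have hzK := hroot u hu z hz
      have hzu := ((mem_roots_levelPoly hj0 hj h0).1 hz).2
      refine logMean_eq_of_posPot_eq hR1 (hle z hzK) hfin (le_antisymm (hpot z hzK) ?_)
      by_contra hlt
      exact hun ⟨z, ⟨hzK, not_le.1 hlt⟩, hzu⟩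
    rw [hall, Multiset.map_const', Multiset.sum_replicate, hcard, nsmul_eq_mul]
  have hfinal : ENNReal.ofReal (Real.log R - c) = ENNReal.ofReal (Real.log R) := by
    rw [← hmut, posEnergy, lintegral_congr_ae hlam_eq]
    simp
  have hlogR : 0 < Real.log R := Real.log_pos hR
  -- `ENNReal.ofReal` is injective only on nonnegative reals; `R > 1` excludes truncation at zero.
  have hpos : 0 < Real.log R - c := by
    rw [← ENNReal.ofReal_pos, hfinal, ENNReal.ofReal_pos]; exact hlogR
  have := (ENNReal.ofReal_eq_ofReal_iff hpos.le hlogR.le).1 hfinal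
  have hc0 : c = 0 := by linarith
  rw [hc] at hc0
  linarith

/-! ### Inversion and the symmetry of Green's functions -/

theorem map_inv_mem_probMeasuresOn {K : Set ℂ} {μ : Measure ℂ} (hK : IsCompact K)
    (hμ : μ ∈ probMeasuresOn K⁻¹) : μ.map Inv.inv ∈ probMeasuresOn K := by
  have := hμ.1
  refine ⟨Measure.isProbabilityMeasure_map measurable_inv.aemeasurable, ?_⟩
  rw [Measure.map_apply measurable_inv hK.measurableSet.compl]
  exact hμ.2

theorem posEnergy_map_inv_ne_top {K : Set ℂ} {μ : Measure ℂ} (hμ : μ ∈ probMeasuresOn K)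
    (h0 : (0 : ℂ) ∉ K) {R : ℝ} (hR : 0 < R) (hK : ∀ z ∈ K, ‖z‖ ≤ R)
    (hfin : posEnergy R μ μ ≠ ∞) : posEnergy R (μ.map Inv.inv) (μ.map Inv.inv) ≠ ∞ := by
  have := hμ.1
  refine posEnergy_map_ne_top (L := R * R) hR (by positivity) measurable_inv
    (ae_mem_of_mem_probMeasuresOn hμ) (fun u hu v hv => ?_) hfin
  have hu0 : u ≠ 0 := fun h => h0 (h ▸ hu)
  have hv0 : v ≠ 0 := fun h => h0 (h ▸ hv)
  have h1 : u - v = -(u * v * (u⁻¹ - v⁻¹)) := by field_simp; ring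
  rw [h1, norm_neg, norm_mul, norm_mul]
  gcongr
  · exact hK u hu
  · exact hK v hv

/-- Symmetry of the Green's function in the poles `0` and `∞`, in terms of the equilibrium
measures of `K` and `1 / K`. -/
theorem energy_add_logMean_zero_eq {K : Set ℂ} (hK : IsCompact K) (hK' : IsCompact K⁻¹)
    (h0 : (0 : ℂ) ∉ K) {μ μ' : Measure ℂ} (hμ : IsEquilibriumMeasure K μ)
    (hμ' : IsEquilibriumMeasure K⁻¹ μ') {R : ℝ} (hR : 1 ≤ R)
    (hKR : ∀ z ∈ K, ∀ w ∈ K, ‖z - w‖ ≤ R) (hKR' : ∀ z ∈ K⁻¹, ∀ w ∈ K⁻¹, ‖z - w‖ ≤ R)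
    (hKb : ∀ z ∈ K, ‖z‖ ≤ R) (hKb' : ∀ z ∈ K⁻¹, ‖z‖ ≤ R)
    (hfin : posEnergy R μ μ ≠ ∞) (hfin' : posEnergy R μ' μ' ≠ ∞) :
    (posEnergy R μ μ).toReal + logMean μ 0 = (posEnergy R μ' μ').toReal + logMean μ' 0 := by
  have := hμ.1.1
  have := hμ'.1.1
  have hR0 : 0 < R := by linarith
  have h0' : (0 : ℂ) ∉ K⁻¹ := by simpa using h0
  have hμK := ae_mem_of_mem_probMeasuresOn hμ.1
  have hμK' := ae_mem_of_mem_probMeasuresOn hμ'.1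
  have hσ : μ'.map Inv.inv ∈ probMeasuresOn K := map_inv_mem_probMeasuresOn hK hμ'.1
  have hlam : μ.map Inv.inv ∈ probMeasuresOn K⁻¹ :=
    map_inv_mem_probMeasuresOn hK' (by rw [inv_inv]; exact hμ.1)
  have hlamp := hlam.1
  have hσfin := posEnergy_map_inv_ne_top hμ'.1 h0' hR0 hKb' hfin'
  have hlamfin := posEnergy_map_inv_ne_top hμ.1 h0 hR0 hKb hfin
  -- The image of `μ'` under inversion is a measure of finite energy on `K`, so it does not charge
  -- the exceptional set of `μ`.
  have hae : ∀ᵐ w ∂μ', posPot R μ w⁻¹ = posEnergy R μ μ :=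
    ae_of_ae_map measurable_inv.aemeasurable (hμ.posPot_ae_eq hK hR hKR hσ hσfin)
  set e := (posEnergy R μ μ).toReal with he
  have hi0 := integrable_log_norm_of_notMem_zero hK hμK h0
  have hi0' := integrable_log_norm_of_notMem_zero hK' hμK' h0'
  have hpot : ∀ᵐ w ∂μ', posPot R (μ.map Inv.inv) w = ENNReal.ofReal (Real.log R -
      (Real.log R - e + Real.log ‖w‖ - logMean μ 0)) ∧
      Real.log R - e + Real.log ‖w‖ - logMean μ 0 ≤ Real.log R := by
    filter_upwards [hae, hμK'] with w hw hwK
    have hw0 : w ≠ 0 := fun h => h0' (h ▸ hwK)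
    have hle : ∀ᵐ z ∂μ, ‖w⁻¹ - z‖ ≤ R := hμK.mono fun z hz => hKR _ hwK z hz
    have hpt : posPot R μ w⁻¹ ≠ ∞ := hw ▸ hfin
    have hi := integrable_log_norm_of_posPot_ne_top hR hle hpt
    have hmean : logMean μ w⁻¹ = Real.log R - e := logMean_eq_of_posPot_eq hR hle hfin hw
    -- From `w - 1/z = -(1/w - z) w / z`; integrating over `z` and then over `w` gives the mutual
    -- energy in terms of `μ`.
    have hlog : ∀ᵐ z ∂μ, w ≠ z⁻¹ ∧ Real.log ‖w - z⁻¹‖ =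
        Real.log ‖w⁻¹ - z‖ + Real.log ‖w‖ - Real.log ‖z‖ := by
      filter_upwards [hμK, ae_ne_of_posPot_ne_top hR0 hpt] with z hz hwz
      have hz0 : z ≠ 0 := fun h => h0 (h ▸ hz)
      refine ⟨fun h => hwz (by rw [h, inv_inv]), ?_⟩
      have h1 : w - z⁻¹ = -((w⁻¹ - z) * w / z) := by field_simp; ring
      rw [h1, norm_neg, norm_div, norm_mul, Real.log_div, Real.log_mul]
      · exact norm_ne_zero_iff.2 (sub_ne_zero.2 hwz)
      · exact norm_ne_zero_iff.2 hw0
      · exact mul_ne_zero (norm_ne_zero_iff.2 (sub_ne_zero.2 hwz)) (norm_ne_zero_iff.2 hw0)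
      · exact norm_ne_zero_iff.2 hz0
    have hi' : Integrable (fun z => Real.log ‖w⁻¹ - z‖ + Real.log ‖w‖) μ :=
      hi.add (integrable_const _)
    have hi2 : Integrable (fun z => Real.log ‖w⁻¹ - z‖ + Real.log ‖w‖ - Real.log ‖z‖) μ :=
      hi'.sub hi0
    have hbd : ∀ᵐ z ∂μ, Real.log ‖w⁻¹ - z‖ + Real.log ‖w‖ - Real.log ‖z‖ ≤ Real.log R := by
      filter_upwards [hμK, hlog] with z hz hlz
      rw [← hlz.2]
      exact log_norm_le_log_of_norm_le hR (hKR' w hwK _ (by simpa using hz))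
    have hval : ∫ z, (Real.log ‖w⁻¹ - z‖ + Real.log ‖w‖ - Real.log ‖z‖) ∂μ =
        Real.log R - e + Real.log ‖w‖ - logMean μ 0 := by
      rw [integral_sub hi' hi0, integral_add hi (integrable_const _), ← logMean_zero,
        ← hmean]
      simp [logMean]
    constructor
    · rw [← hval, ← lintegral_ofReal_const_sub hi2 hbd, posPot,
        lintegral_map (measurable_posKernel_right R w) measurable_inv]
      refine lintegral_congr_ae ?_
      filter_upwards [hlog] with z hz
      rw [posKernel_eq_ofReal_sub hR0 hz.1, hz.2]
    · rw [← hval]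
      calc _ ≤ ∫ _z, Real.log R ∂μ := integral_mono_ae hi2 (integrable_const _) hbd
        _ = _ := by simp
  have hg1 : Integrable (fun w => Real.log R - e + Real.log ‖w‖) μ' :=
    (integrable_const _).add hi0'
  have hg : Integrable (fun w => Real.log R - e + Real.log ‖w‖ - logMean μ 0) μ' :=
    hg1.sub (integrable_const _)
  have hgval : ∫ w, (Real.log R - e + Real.log ‖w‖ - logMean μ 0) ∂μ' =
      Real.log R - e + logMean μ' 0 - logMean μ 0 := by
    rw [integral_sub hg1 (integrable_const _), integral_add (integrable_const _) hi0',
      ← logMean_zero]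
    simp
  have hgle : Real.log R - e + logMean μ' 0 - logMean μ 0 ≤ Real.log R := by
    rw [← hgval]
    calc _ ≤ ∫ _w, Real.log R ∂μ' :=
          integral_mono_ae hg (integrable_const _) (hpot.mono fun w hw => hw.2)
      _ = _ := by simp
  have hE1 : posEnergy R μ' (μ.map Inv.inv) =
      ENNReal.ofReal (Real.log R - (Real.log R - e + logMean μ' 0 - logMean μ 0)) := by
    rw [← hgval, ← lintegral_ofReal_const_sub hg (hpot.mono fun w hw => hw.2), posEnergy]
    exact lintegral_congr_ae (hpot.mono fun w hw => hw.1)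
  -- The same mutual energy, evaluated by Frostman's theorem for `μ'`.
  rw [posEnergy_comm, hμ'.posEnergy_eq hK' hR hKR' hlam hlamfin] at hE1
  rw [hE1, ENNReal.toReal_ofReal (by linarith)]
  ring

/-! ### Green's functions and the value of Cantor's matrix -/

theorem isEquilibriumMeasure_equilibriumMeasure {K : Set ℂ} (hK : IsCompact K)
    (hne : K.Nonempty) : IsEquilibriumMeasure K (equilibriumMeasure K) := by
  have h := exists_isEquilibriumMeasure hK hne
  rw [equilibriumMeasure, dif_pos h]
  exact h.choose_spec

theorem IsEquilibriumMeasure.iInf_logEnergy {K : Set ℂ} {μ : Measure ℂ}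
    (hμ : IsEquilibriumMeasure K μ) : ⨅ ν ∈ probMeasuresOn K, logEnergy ν = logEnergy μ :=
  le_antisymm (iInf₂_le μ hμ.1) (le_iInf₂ hμ.2)

theorem logEnergy_eq_coe {K : Set ℂ} {ν : Measure ℂ} (hν : ν ∈ probMeasuresOn K) {R : ℝ}
    (hR : 1 ≤ R) (h : ∀ z ∈ K, ∀ w ∈ K, ‖z - w‖ ≤ R) (hfin : posEnergy R ν ν ≠ ∞) :
    logEnergy ν = (((posEnergy R ν ν).toReal - Real.log R : ℝ) : EReal) := by
  rw [logEnergy_eq hν hR h, EReal.coe_sub, EReal.coe_ennreal_toReal hfin]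

theorem greenInfty_eq {K : Set ℂ} (hK : IsCompact K)
    (hμ : IsEquilibriumMeasure K (equilibriumMeasure K)) {R : ℝ} (hR : 1 ≤ R)
    (h : ∀ z ∈ K, ∀ w ∈ K, ‖z - w‖ ≤ R)
    (hfin : posEnergy R (equilibriumMeasure K) (equilibriumMeasure K) ≠ ∞) {z : ℂ} (hz : z ∉ K) :
    greenInfty K z = (posEnergy R (equilibriumMeasure K) (equilibriumMeasure K)).toReal -
      Real.log R + logMean (equilibriumMeasure K) z := by
  have := hμ.1.1
  have hae := ae_mem_of_mem_probMeasuresOn hμ.1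
  obtain ⟨D, hD⟩ := ae_norm_sub_le hK hae z
  obtain ⟨d, hd, hdK⟩ := exists_pos_le_norm_sub hK hz
  have hD' : ∀ᵐ w ∂(equilibriumMeasure K), ‖z - w‖ ≤ max 1 D :=
    hD.mono fun w hw => hw.trans (le_max_right _ _)
  have hpt : posPot (max 1 D) (equilibriumMeasure K) z ≠ ∞ :=
    posPot_ne_top_of_le_norm (lt_of_lt_of_le one_pos (le_max_left _ _)) hd (hae.mono hdK)
  rw [greenInfty, logEnergy_eq_coe hμ.1 hR h hfin, logPotential_eq_coe (le_max_left _ _) hD' hpt,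
    ← EReal.coe_sub, EReal.toReal_coe, sub_neg_eq_add]
  rfl

/-- For `|z| ≥ 2C`, with `C` bounding `S`, the logarithms of `|z - w|` and `|z|` differ by at most
`2C / |z|`, uniformly in `w ∈ S`. -/
theorem tendsto_logMean_sub_log_norm {ν : Measure ℂ} [IsProbabilityMeasure ν] {S : Set ℂ}
    (hS : IsCompact S) (hν : ∀ᵐ w ∂ν, w ∈ S) :
    Tendsto (fun z => logMean ν z - Real.log ‖z‖) (Bornology.cobounded ℂ) (𝓝 0) := by
  obtain ⟨C, hC0, hC⟩ := hS.isBounded.exists_pos_norm_le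
  have hlim : Tendsto (fun z : ℂ => C / (‖z‖ / 2)) (Bornology.cobounded ℂ) (𝓝 0) :=
    (tendsto_norm_cobounded_atTop.atTop_div_const two_pos).const_div_atTop C
  refine squeeze_zero_norm' ?_ hlim
  filter_upwards [tendsto_norm_cobounded_atTop.eventually_ge_atTop (2 * C)] with z hz
  have hd : 0 < ‖z‖ / 2 := by linarith
  have hzS : z ∉ S := fun h => by linarith [hC z h]
  have hi := integrable_log_norm_of_notMem hS hν hzS
  have hsub : logMean ν z - Real.log ‖z‖ = ∫ w, (Real.log ‖z - w‖ - Real.log ‖z‖) ∂ν := by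
    rw [integral_sub hi (integrable_const _)]
    simp [logMean]
  rw [hsub]
  refine (norm_integral_le_of_norm_le_const (C := C / (‖z‖ / 2)) (hν.mono fun w hw => ?_)).trans_eq
    (by simp)
  have hw := hC w hw
  have h1 : ‖z‖ / 2 ≤ ‖z - w‖ := by
    have := norm_sub_norm_le z w
    linarith
  have ha := log_norm_sub_le_add_div (z := z) (z' := z - w) (w := 0) hd
    (by rw [sub_zero]; linarith) (by rw [sub_zero]; exact h1)
  have hb := log_norm_sub_le_add_div (z := z - w) (z' := z) (w := 0) hd
    (by rw [sub_zero]; exact h1) (by rw [sub_zero]; linarith)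
  simp only [sub_zero, sub_sub_cancel_left, norm_neg, sub_sub_cancel] at ha hb
  have h2 : ‖w‖ / (‖z‖ / 2) ≤ C / (‖z‖ / 2) := by gcongr
  rw [Real.norm_eq_abs, abs_le]
  constructor <;> linarith

/-- By symmetry the positive vector `(a, b)` annihilates `Γ` from the left as well, so for every `s`
the entries of `Γ s` have weighted sum zero and cannot both be positive; `s = (a, b)` attains zero.
-/
theorem matrixValue_eq_zero {Γ : Matrix (Fin 2) (Fin 2) ℝ} (hsymm : Γ 0 1 = Γ 1 0) {a b : ℝ}
    (ha : 0 < a) (hb : 0 < b) (hab : a + b = 1) (h0 : a * Γ 0 0 + b * Γ 0 1 = 0)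
    (h1 : a * Γ 1 0 + b * Γ 1 1 = 0) : matrixValue Γ = 0 := by
  have hg : IsGreatest ((fun s : Fin 2 → ℝ =>
      min (Γ 0 0 * s 0 + Γ 0 1 * s 1) (Γ 1 0 * s 0 + Γ 1 1 * s 1)) '' stdSimplex ℝ (Fin 2)) 0 := by
    constructor
    · refine ⟨![a, b], ⟨?_, ?_⟩, ?_⟩
      · intro i; fin_cases i <;> simp [ha.le, hb.le]
      · simpa [Fin.sum_univ_two] using hab
      · have e0 : Γ 0 0 * a + Γ 0 1 * b = 0 := by linarith
        have e1 : Γ 1 0 * a + Γ 1 1 * b = 0 := by linarith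
        simp [e0, e1]
    · rintro _ ⟨s, -, rfl⟩
      by_contra! hlt
      obtain ⟨hx, hy⟩ := lt_min_iff.1 hlt
      have h2 := mul_pos ha hx
      have h3 := mul_pos hb hy
      have h4 : a * (Γ 0 0 * s 0 + Γ 0 1 * s 1) + b * (Γ 1 0 * s 0 + Γ 1 1 * s 1) =
          (a * Γ 0 0 + b * Γ 0 1) * s 0 + (a * Γ 1 0 + b * Γ 1 1) * s 1 := by
        rw [hsymm]; ring
      rw [h0, h1] at h4
      linarith
  exact hg.csSup_eq

open Polynomial in
-- The reversed polynomial is `z^n P(1/z)`, so dividing it by `z^(n-j)` gives `r(1/z)`.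
theorem inv_ratPreimage {P : ℂ[X]} {j : ℕ} (hj : j < P.natDegree) (E : Set ℂ) :
    (ratPreimage P j E)⁻¹ = ratPreimage P.reverse (P.natDegree - j) E := by
  ext z
  rw [Set.mem_inv]
  by_cases hz : z = 0
  · subst hz; simp [ratPreimage]
  have h1 : P.reverse.eval z = P.eval z⁻¹ * z ^ P.natDegree := by
    let : Invertible z⁻¹ := invertibleOfNonzero (inv_ne_zero hz)
    have := eval₂_reverse_mul_pow (RingHom.id ℂ) z⁻¹ P
    rw [invOf_eq_inv, inv_inv, eval₂_id, eval₂_id] at this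
    rw [← this, mul_assoc, ← mul_pow, inv_mul_cancel₀ hz, one_pow, mul_one]
  have h2 : P.reverse.eval z / z ^ (P.natDegree - j) = P.eval z⁻¹ / z⁻¹ ^ j := by
    rw [h1, div_eq_div_iff (pow_ne_zero _ hz) (pow_ne_zero _ (inv_ne_zero hz)), mul_assoc,
      pow_sub₀ z hz hj.le, inv_pow]
  change (z⁻¹ ≠ 0 ∧ _ ∈ E) ↔ (z ≠ 0 ∧ _ ∈ E)
  rw [h2]
  simp [hz]

open Polynomial in
theorem natTrailingDegree_eq_zero_of_coeff_zero_ne {P : ℂ[X]} (h0 : P.coeff 0 ≠ 0) :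
    P.natTrailingDegree = 0 :=
  natTrailingDegree_eq_zero.2 (Or.inr h0)

theorem tendsto_greenInfty_sub_log {K : Set ℂ} (hK : IsCompact K)
    (hμ : IsEquilibriumMeasure K (equilibriumMeasure K)) {R : ℝ} (hR : 1 ≤ R)
    (h : ∀ z ∈ K, ∀ w ∈ K, ‖z - w‖ ≤ R)
    (hfin : posEnergy R (equilibriumMeasure K) (equilibriumMeasure K) ≠ ∞) :
    Tendsto (fun z => greenInfty K z - Real.log ‖z‖) (Bornology.cobounded ℂ)
      (𝓝 ((posEnergy R (equilibriumMeasure K) (equilibriumMeasure K)).toReal - Real.log R)) := by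
  have := hμ.1.1
  have hlim := (tendsto_logMean_sub_log_norm hK (ae_mem_of_mem_probMeasuresOn hμ.1)).const_add
    ((posEnergy R (equilibriumMeasure K) (equilibriumMeasure K)).toReal - Real.log R)
  rw [add_zero] at hlim
  refine hlim.congr' ?_
  filter_upwards [Bornology.isBounded_def.1 hK.isBounded] with z hz
  rw [greenInfty_eq hK hμ hR h hfin hz]
  ring

theorem tendsto_greenZero_add_log {K : Set ℂ} {c : ℝ}
    (h : Tendsto (fun z => greenInfty K⁻¹ z - Real.log ‖z‖) (Bornology.cobounded ℂ) (𝓝 c)) :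
    Tendsto (fun z => greenZero K z + Real.log ‖z‖) (𝓝[≠] 0) (𝓝 c) := by
  have h1 := h.comp tendsto_inv₀_nhdsNE_zero
  refine h1.congr fun z => ?_
  simp [greenZero]

end CantorCapacity

end

/-! ### Assembling the balance equations -/

open CantorCapacity in
theorem proposition5p3 (E : Set ℂ) (hE : IsCompact E) (hcap : CantorCapacity.logCapacity E = 1)
    (n j : ℕ) (hj : 0 < j) (hjn : j < n)
    (P : Polynomial ℂ) (hP : P.Monic) (hdeg : P.natDegree = n)
    (h0 : P.coeff 0 = 1 ∨ P.coeff 0 = -1)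
    (K : Set ℂ) (hK : K = CantorCapacity.ratPreimage P j E) :
    -- `K` is a compact non-polar subset of `ℂ \ {0}`, and the limits defining `Γ(K)` exist
    (IsCompact K ∧ (0 : ℂ) ∉ K ∧ 0 < CantorCapacity.logCapacity K ∧
      Tendsto (fun z : ℂ => CantorCapacity.greenZero K z + Real.log ‖z‖) (𝓝[≠] 0)
        (𝓝 (CantorCapacity.cantorMatrix K 0 0)) ∧
      Tendsto (fun z : ℂ => CantorCapacity.greenInfty K z - Real.log ‖z‖)
        (Bornology.cobounded ℂ) (𝓝 (CantorCapacity.cantorMatrix K 1 1))) ∧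
    CantorCapacity.capZeroInfty K = 1 ∧
    -- `(j / n, (n - j) / n)` is a probability vector which balances `Γ(K)`
    ![(j : ℝ) / n, ((n : ℝ) - j) / n] ∈ stdSimplex ℝ (Fin 2) ∧
    (j : ℝ) / n * CantorCapacity.cantorMatrix K 0 0 +
        ((n : ℝ) - j) / n * CantorCapacity.cantorMatrix K 0 1 =
      CantorCapacity.robinConstant K ∧
    (j : ℝ) / n * CantorCapacity.cantorMatrix K 1 0 +
        ((n : ℝ) - j) / n * CantorCapacity.cantorMatrix K 1 1 =
      CantorCapacity.robinConstant K := by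
  subst hK
  set K := ratPreimage P j E with hKdef
  have h0' : P.coeff 0 ≠ 0 := by rcases h0 with h | h <;> simp [h]
  have h0n : ‖P.coeff 0‖ = 1 := by rcases h0 with h | h <;> simp [h]
  have hlead : ‖P.leadingCoeff‖ = 1 := by rw [hP.leadingCoeff]; simp
  have hjP : j < P.natDegree := hdeg.symm ▸ hjn
  have htr := natTrailingDegree_eq_zero_of_coeff_zero_ne h0'
  have hrevdeg : P.reverse.natDegree = n := by
    rw [Polynomial.reverse_natDegree, htr, hdeg, Nat.sub_zero]
  have hrevlead : ‖P.reverse.leadingCoeff‖ = 1 := by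
    rw [Polynomial.reverse_leadingCoeff, Polynomial.trailingCoeff, htr]; exact h0n
  have hrev0 : P.reverse.coeff 0 ≠ 0 := by
    rw [Polynomial.coeff_zero_reverse, hP.leadingCoeff]; exact one_ne_zero
  have hj' : 0 < n - j := by omega
  have hjP' : n - j < P.reverse.natDegree := by rw [hrevdeg]; omega
  have hinv : K⁻¹ = ratPreimage P.reverse (n - j) E := by
    rw [hKdef, inv_ratPreimage hjP, hdeg]
  have hKc : IsCompact K := isCompact_ratPreimage hj hjP h0' hE
  have hKc' : IsCompact K⁻¹ := hinv ▸ isCompact_ratPreimage hj' hjP' hrev0 hE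
  have hK0 : (0 : ℂ) ∉ K := fun h => h.1 rfl
  have hK0' : (0 : ℂ) ∉ K⁻¹ := by simpa using hK0
  -- For empty `E` the infimum of the energies is `⊤` and the capacity would be zero.
  have hEne : E.Nonempty := by
    by_contra hemp
    rw [Set.not_nonempty_iff_eq_empty] at hemp
    have : logCapacity E = 0 := by
      rw [logCapacity, EReal.exp_eq_zero_iff, EReal.neg_eq_bot_iff]
      refine iInf₂_eq_top.2 fun ν hν => ?_
      have h1 := hν.1.measure_univ
      have h2 := hν.2
      rw [hemp, compl_empty, h1] at h2
      exact absurd h2 one_ne_zero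
    rw [this] at hcap
    exact zero_ne_one hcap
  have hKne : K.Nonempty := by
    have himg := image_ratPreimage hj hjP h0' E
    rw [← himg] at hEne
    exact hEne.of_image
  have hKne' : K⁻¹.Nonempty := hKne.inv
  obtain ⟨ν, hν⟩ := exists_isEquilibriumMeasure hE hEne
  have hμ := isEquilibriumMeasure_equilibriumMeasure hKc hKne
  have hμ' := isEquilibriumMeasure_equilibriumMeasure hKc' hKne'
  set μ := equilibriumMeasure K with hμdef
  set μ' := equilibriumMeasure K⁻¹ with hμ'def
  obtain ⟨C, hC0, hC⟩ := ((hE.union hKc).union hKc').isBounded.exists_pos_norm_le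
  obtain ⟨R, hR, hRC⟩ : ∃ R : ℝ, 1 < R ∧ 2 * C ≤ R := ⟨2 * C + 2, by linarith, by linarith⟩
  have hbd : ∀ z w : ℂ, ‖z‖ ≤ C → ‖w‖ ≤ C → ‖z - w‖ ≤ R := fun z w hz hw =>
    (norm_sub_le z w).trans (by linarith)
  have hER : ∀ z ∈ E, ∀ w ∈ E, ‖z - w‖ ≤ R := fun z hz w hw =>
    hbd z w (hC z (Or.inl (Or.inl hz))) (hC w (Or.inl (Or.inl hw)))
  have hKR : ∀ z ∈ K, ∀ w ∈ K, ‖z - w‖ ≤ R := fun z hz w hw =>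
    hbd z w (hC z (Or.inl (Or.inr hz))) (hC w (Or.inl (Or.inr hw)))
  have hKR' : ∀ z ∈ K⁻¹, ∀ w ∈ K⁻¹, ‖z - w‖ ≤ R := fun z hz w hw =>
    hbd z w (hC z (Or.inr hz)) (hC w (Or.inr hw))
  have hKb : ∀ z ∈ K, ‖z‖ ≤ R := fun z hz => (hC z (Or.inl (Or.inr hz))).trans (by linarith)
  have hKb' : ∀ z ∈ K⁻¹, ‖z‖ ≤ R := fun z hz => (hC z (Or.inr hz)).trans (by linarith)
  have hνR : posEnergy R ν ν = ENNReal.ofReal (Real.log R) := by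
    have hzero : logEnergy ν = 0 := by
      rw [logCapacity, hν.iInf_logEnergy] at hcap
      have h1 : -logEnergy ν = 0 :=
        EReal.exp_strictMono.injective (hcap.trans EReal.exp_zero.symm)
      rw [← neg_neg (logEnergy ν), h1, neg_zero]
    have hfin : posEnergy R ν ν ≠ ∞ := by
      intro htop
      rw [logEnergy_eq hν.1 hR.le hER, htop, EReal.coe_ennreal_top, EReal.top_sub_coe] at hzero
      exact absurd hzero (by simp)
    rw [logEnergy_eq_coe hν.1 hR.le hER hfin] at hzero
    have h1 : (posEnergy R ν ν).toReal - Real.log R = 0 := by exact_mod_cast hzero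
    rw [← ENNReal.ofReal_toReal hfin]
    congr 1
    linarith
  obtain ⟨hfin, hbal⟩ := natDegree_mul_energy_ratPreimage hj hjP hlead h0' hE hν hμ hR hER hKR hνR
  have hμ'rev : IsEquilibriumMeasure (ratPreimage P.reverse (n - j) E) μ' := hinv ▸ hμ'
  obtain ⟨hfin', hbal'⟩ := natDegree_mul_energy_ratPreimage hj' hjP' hrevlead hrev0 hE hν hμ'rev
    hR hER (hinv ▸ hKR') hνR
  have hsymm := energy_add_logMean_zero_eq hKc hKc' hK0 hμ hμ' hR.le hKR hKR' hKb hKb' hfin hfin'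
  rw [hdeg] at hbal
  rw [hrevdeg, Nat.cast_sub hjn.le] at hbal'
  have hlimInf := tendsto_greenInfty_sub_log hKc hμ hR.le hKR hfin
  have hlimZero := tendsto_greenZero_add_log (tendsto_greenInfty_sub_log hKc' hμ' hR.le hKR' hfin')
  have h00 : cantorMatrix K 0 0 = (posEnergy R μ' μ').toReal - Real.log R := hlimZero.limUnder_eq
  have h11 : cantorMatrix K 1 1 = (posEnergy R μ μ).toReal - Real.log R := hlimInf.limUnder_eq
  have h01 : cantorMatrix K 0 1 = (posEnergy R μ μ).toReal - Real.log R + logMean μ 0 :=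
    greenInfty_eq hKc hμ hR.le hKR hfin hK0
  have h10 : cantorMatrix K 1 0 = (posEnergy R μ' μ').toReal - Real.log R + logMean μ' 0 :=
    greenInfty_eq hKc' hμ' hR.le hKR' hfin' hK0'
  have hn0 : (0 : ℝ) < n := by exact_mod_cast hj.trans hjn
  have hj0 : (0 : ℝ) < j := by exact_mod_cast hj
  have hnj0 : (0 : ℝ) < (n : ℝ) - j := by
    have : (j : ℝ) < n := by exact_mod_cast hjn
    linarith
  have hs0 : 0 < (j : ℝ) / n := div_pos hj0 hn0
  have hs1 : 0 < ((n : ℝ) - j) / n := div_pos hnj0 hn0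
  have hsum : (j : ℝ) / n + ((n : ℝ) - j) / n = 1 := by field_simp; ring
  have hrow0 : (j : ℝ) / n * cantorMatrix K 0 0 + ((n : ℝ) - j) / n * cantorMatrix K 0 1 = 0 := by
    rw [div_mul_eq_mul_div, div_mul_eq_mul_div, ← add_div, div_eq_zero_iff]
    left
    rw [h00, h01]
    -- Symmetry replaces `g_K(0,∞)` by `g_K(∞,0)`, leaving only the balance relation of `1/K`; the
    -- other row uses that of `K`.
    linear_combination ((n : ℝ) - j) * hsymm - hbal'
  have hrow1 : (j : ℝ) / n * cantorMatrix K 1 0 + ((n : ℝ) - j) / n * cantorMatrix K 1 1 = 0 := by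
    rw [div_mul_eq_mul_div, div_mul_eq_mul_div, ← add_div, div_eq_zero_iff]
    left
    rw [h10, h11]
    linear_combination -(j : ℝ) * hsymm - hbal
  have hsym : cantorMatrix K 0 1 = cantorMatrix K 1 0 := by
    rw [h01, h10]; linarith
  have hval : robinConstant K = 0 := matrixValue_eq_zero hsym hs0 hs1 hsum hrow0 hrow1
  refine ⟨⟨hKc, hK0, ?_, h00 ▸ hlimZero, h11 ▸ hlimInf⟩, ?_, ?_, ?_, ?_⟩
  · rw [logCapacity, hμ.iInf_logEnergy, logEnergy_eq_coe hμ.1 hR.le hKR hfin, ← EReal.coe_neg,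
      EReal.exp_coe, ENNReal.ofReal_pos]
    exact Real.exp_pos _
  · rw [capZeroInfty, hval, neg_zero, Real.exp_zero]
  · refine ⟨fun i => ?_, ?_⟩
    · fin_cases i
      · exact hs0.le
      · exact hs1.le
    · simpa [Fin.sum_univ_two] using hsum
  · rw [hrow0, hval]
  · rw [hrow1, hval]
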